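/- Let $1<p<\infty$. For a measurable function $F$ on a measure space $(X,\mu)$ put $\|F\|_{p,\infty}=\sup_{y}\,y\,\mu\{x:|F(x)|\ge y\}^{1/p}$, and for a sequence $w=(w_t)_{t\in\mathbb N}$ of positive real numbers put $C_p(w)=\sup_{y}\,y\,|\{t: w_t\ge y\}|^{1/p}$, the suprema being over finite $y\ge 0$. A sequence $(T_n)_{n\ge1}$ of linear operators on $L^p(X,\mu)$ is called *ultimately bad in $L^p$* if for every sequence $(w_t)$ of positive real numbers with $C_p(w)=\infty$ there is no constant $C>0$ such that $$\Big\|\sup_t \frac{w_t}{2^t}\sum_{1\le n\le 2^t}T_nf\Big\|_{p,\infty}\le C\,\|f\|_p\qquad\text{for all } f\in L^p .$$ **Theorem.** Let $1<p<\infty$ and let $[0,1)$ carry Lebesgue measure. 1. The sequence of operators $T_nf(x)=f(nx\bmod 1)$, $n\ge1$, on (real) $L^p[0,1)$ is ultimately bad in $L^p$. 2. Consequently the sums $K_Nf(x)=\sum_{n=1}^{N}f(nx\bmod 1)$ diverge almost everywhere at the maximal rate $N(\log N)^{1/p}$, in the following sense. - For every sequence $(M_N)_{N\ge1}$ of positive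 real numbers with $M_N/(N(\log N)^{1/p})\to0$ there is an $f\in L^p[0,1)$ such that $\limsup_{N\to\infty}K_Nf(x)/M_N=\infty$ for almost every $x\in[0,1)$. - The rate is maximal: for every $f\in L^p[0,1)$, $\lim_{N\to\infty}K_Nf(x)/(N(\log N)^{1/p})=0$ for almost every $x\in[0,1)$. (Taking $M_N=N$, there is $f\in L^p[0,1)$ whose averages $\frac1N K_Nf(x)$ are unbounded for almost every $x$, so Khintchine's conjecture fails in every $L^p$, $1<p<\infty$.) -/

import Mathlib

open MeasureTheory Filter Topology
open scoped ENNReal NNReal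

namespace KhintchineSums

noncomputable section

/-- The weak norm `‖F‖_{p,∞} = sup_y y · μ{x : |F x| ≥ y}^{1/p}` of a function with values in
`[-∞, ∞]`; the supremum is over finite `y ≥ 0`. -/
def weakNorm {X : Type*} [MeasurableSpace X] (p : ℝ) (μ : Measure X) (F : X → EReal) : ℝ≥0∞ :=
  ⨆ y : ℝ≥0, (y : ℝ≥0∞) * (μ {x | (y : ℝ≥0∞) ≤ (F x).abs}) ^ (1 / p)

/-- `C_p(w)` for `1 < p < ∞` and a sequence `w` of positive reals: its weak `ℓ^p` norm
`sup_y y · #{t : w t ≥ y}^{1/p}`. -/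
def weightConst (p : ℝ) (w : ℕ → ℝ) : ℝ≥0∞ :=
  weakNorm p Measure.count (fun t => ((w t : ℝ) : EReal))

section Operators

variable {X : Type*} [MeasurableSpace X] {μ : Measure X} {p : ℝ}

/-- The dyadic average `A_t f = 2^{-t} ∑_{1 ≤ n ≤ 2^t} T_n f`. -/
def dyadicAverage (T : ℕ+ → Lp ℝ (ENNReal.ofReal p) μ →ₗ[ℝ] Lp ℝ (ENNReal.ofReal p) μ) (t : ℕ)
    (f : Lp ℝ (ENNReal.ofReal p) μ) : Lp ℝ (ENNReal.ofReal p) μ :=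
  ((2 : ℝ) ^ t)⁻¹ • ∑ n ∈ Finset.Icc (1 : ℕ+) (2 ^ t), T n f

/-- The maximal function `sup_t w_t A_t f`, with values in `[-∞, ∞]`. -/
def weightedMaximal (T : ℕ+ → Lp ℝ (ENNReal.ofReal p) μ →ₗ[ℝ] Lp ℝ (ENNReal.ofReal p) μ)
    (w : ℕ → ℝ) (f : Lp ℝ (ENNReal.ofReal p) μ) (x : X) : EReal :=
  ⨆ t : ℕ, ((w t * dyadicAverage T t f x : ℝ) : EReal)

/-- The weak `(p,p)` maximal inequality for the sequence of operators `w_t A_t`. -/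
def SatisfiesWeakMaximal
    (T : ℕ+ → Lp ℝ (ENNReal.ofReal p) μ →ₗ[ℝ] Lp ℝ (ENNReal.ofReal p) μ) (w : ℕ → ℝ) : Prop :=
  ∃ C : ℝ≥0, 0 < C ∧ ∀ f : Lp ℝ (ENNReal.ofReal p) μ,
    weakNorm p μ (weightedMaximal T w f) ≤ C * eLpNorm f (ENNReal.ofReal p) μ

/-- The sequence `T` of linear operators on `L^p` (`1 < p < ∞`) is ultimately bad: the maximal
inequality fails for every sequence of positive weights with `C_p(w) = ∞`. -/
def UltimatelyBad (T : ℕ+ → Lp ℝ (ENNReal.ofReal p) μ →ₗ[ℝ] Lp ℝ (ENNReal.ofReal p) μ) : Prop :=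
  ∀ w : ℕ → ℝ, (∀ t, 0 < w t) → weightConst p w = ∞ → ¬ SatisfiesWeakMaximal T w

end Operators

/-- Lebesgue measure on `[0,1)`. -/
abbrev unitMeasure : Measure ℝ := volume.restrict (Set.Ico 0 1)

/-- The map `x ↦ n x mod 1`. -/
def mulMod (n : ℕ) (x : ℝ) : ℝ := Int.fract (n * x)

lemma measurePreserving_fract_section :
    MeasurePreserving (fun y : UnitAddCircle => (AddCircle.equivIco 1 0 y : ℝ))
      volume unitMeasure := by
  have hmeas : Measurable (fun y : UnitAddCircle => (AddCircle.equivIco 1 0 y : ℝ)) :=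
    measurable_subtype_coe.comp (AddCircle.measurableEquivIco 1 0).measurable
  have hmk := UnitAddCircle.measurePreserving_mk 0
  rw [zero_add, ← Measure.restrict_congr_set (Ico_ae_eq_Ioc (μ := volume))] at hmk
  refine ⟨hmeas, ?_⟩
  rw [← hmk.map_eq, Measure.map_map hmeas hmk.measurable]
  have h : ((fun y : UnitAddCircle => (AddCircle.equivIco 1 0 y : ℝ)) ∘ fun x : ℝ =>
      (x : UnitAddCircle)) =ᵐ[volume.restrict (Set.Ico (0 : ℝ) 1)] id := by
    filter_upwards [ae_restrict_mem measurableSet_Ico] with x hx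
    have := AddCircle.coe_equivIco_mk_apply (1 : ℝ) x
    simp only [Function.comp_apply, id]
    refine this.trans ?_
    rw [div_one, mul_one, Int.fract_eq_self.2 hx]
  rw [Measure.map_congr h, Measure.map_id]

lemma measurePreserving_mulMod {n : ℕ} (hn : n ≠ 0) :
    MeasurePreserving (mulMod n) unitMeasure unitMeasure := by
  have hmk := UnitAddCircle.measurePreserving_mk 0
  rw [zero_add, ← Measure.restrict_congr_set (Ico_ae_eq_Ioc (μ := volume))] at hmk
  have hsm : MeasurePreserving (fun y : UnitAddCircle => n • y) volume volume := by
    rcases Nat.lt_or_ge 1 n with h | h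
    · exact (AddCircle.ergodic_nsmul h).toMeasurePreserving
    · obtain rfl : n = 1 := by omega
      simp only [one_smul]
      exact MeasurePreserving.id (volume : Measure UnitAddCircle)
  have h := measurePreserving_fract_section.comp (hsm.comp hmk)
  refine (congrArg (fun g => MeasurePreserving g unitMeasure unitMeasure) ?_).mpr h
  funext x
  have := AddCircle.coe_equivIco_mk_apply (1 : ℝ) (n * x)
  rw [div_one, mul_one] at this
  simp only [mulMod, Function.comp_apply]
  rw [← this, ← AddCircle.coe_nsmul, nsmul_eq_mul]

/-- The operator `T_n f (x) = f (n x mod 1)` on `L^p[0,1)`, for `n ≥ 1`. -/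
def khintchineOp (p : ℝ) (n : ℕ+) :
    Lp ℝ (ENNReal.ofReal p) unitMeasure →ₗ[ℝ] Lp ℝ (ENNReal.ofReal p) unitMeasure :=
  Lp.compMeasurePreservingₗ ℝ (mulMod n) (measurePreserving_mulMod n.ne_zero)

lemma khintchineOp_coeFn (p : ℝ) (n : ℕ+) (f : Lp ℝ (ENNReal.ofReal p) unitMeasure) :
    khintchineOp p n f =ᵐ[unitMeasure] fun x => f (Int.fract ((n : ℕ) * x)) :=
  Lp.coeFn_compMeasurePreserving f (measurePreserving_mulMod n.ne_zero)

/-- The Khintchine sum `K_N f (x) = ∑_{1 ≤ n ≤ N} f (n x mod 1)`. -/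
def khintchineSum (f : ℝ → ℝ) (N : ℕ) (x : ℝ) : ℝ :=
  ∑ n ∈ Finset.Icc 1 N, f (mulMod n x)

end

end KhintchineSums

namespace KhintchineSums

/-! The positive integers under multiplication form an amenable semigroup, so the commuting
operators `f ↦ f (n ·)` have joint approximate eigenfunctions. A trigonometric polynomial on an
almost invariant set of frequencies, with coefficients `m ^ (-iθ / log 2)`, satisfies `F (n x) ≈ n ^
(iθ / log 2) F x` for all `n ≤ 2 ^ T`, off a set carrying at most half of its L² mass. For `2 ^
(t-1) < n ≤ 2 ^ t` the eigenvalue is close to `ω t = exp (iθt)`, so each dyadic block acts roughly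
as a rotation of the value of `F`.

Fix `z ∈ ℂ` and let `E` be the set where `F x` is relatively close to `z`. If `x` is good and `z`
lies near `ω t * F x`, then `n x ∈ E` for the whole block, which is half of all `n ≤ 2 ^ t`. The
discs about `ω t * F x`, `t ∈ S`, are disjoint, so integrating over `z` gives some `E` for which the
set `B` of points with a large average at a scale in `S` has measure at least a constant times
`S.card` times that of `E` (`exists_largeAverageSet`). Testing a weak maximal inequality on `1_E`,
with `S` inside a level set of `w`, bounds `C_p(w)`; hence ultimate badness.

For divergence, multiplication by large `q` is mixing and commutes with the averages. A union of
preimages of `E` therefore enlarges `B` to nearly full measure, while `S.card` times the measure of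
`E` stays bounded. Taking `S = [n, 2n)`, heights of order `n ^ (1/p)` and a supremum over such sets
gives the function, by Borel–Cantelli.

The converse bound truncates `f` at height `η (t+1) ^ (1/p)` on the scale `2 ^ t`. Markov's
inequality bounds the tails, and these bounds sum to a multiple of the integral of `|f| ^ p`. -/

/-- Finite sets of positive integers that are almost invariant under multiplication by `1, …, N`. -/
lemma exists_almost_invariant_finset (N : ℕ) {ε : ℝ} (hε : 0 < ε) :
    ∃ A A' : Finset ℕ, A.Nonempty ∧ A ⊆ A' ∧ (∀ m ∈ A, m ≠ 0) ∧
      (∀ n ∈ Finset.Icc 1 N, ∀ m ∈ A, n * m ∈ A') ∧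
      (A'.card : ℝ) ≤ (1 + ε) * A.card := by
  -- Products of powers of `1, …, N` with exponents at most `K`. Multiplying by `n ≤ N` raises one
  -- exponent, so it maps `B K` into `B (K + 1)`. `φ` need not be injective; only an upper bound on
  -- the cardinality is needed.
  let φ : (Fin N → ℕ) → ℕ := fun a => ∏ j : Fin N, ((j : ℕ) + 1) ^ a j
  let B : ℕ → Finset ℕ := fun K =>
    (Fintype.piFinset fun _ : Fin N => Finset.range (K + 1)).image φ
  have hmem : ∀ K m, m ∈ B K ↔ ∃ a : Fin N → ℕ, (∀ j, a j < K + 1) ∧ φ a = m := by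
    intro K m
    simp [B, Fintype.mem_piFinset]
  have hcard : ∀ K, (B K).card ≤ (K + 1) ^ N := by
    intro K
    refine Finset.card_image_le.trans ?_
    simp
  have hone : ∀ K, 1 ∈ B K := fun K => (hmem K 1).2 ⟨0, fun _ => by simp, by simp [φ]⟩
  -- Otherwise the cardinalities would grow geometrically, against the polynomial bound `(K + 1) ^
  -- N`.
  have hgrowth : ∃ K, ((B (K + 1)).card : ℝ) ≤ (1 + ε) * (B K).card := by
    by_contra! hcon
    have hlow : ∀ K, (1 + ε) ^ K ≤ ((B K).card : ℝ) := by
      intro K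
      induction K with
      | zero =>
        have : 1 ≤ (B 0).card := Finset.card_pos.2 ⟨1, hone 0⟩
        simpa using (Nat.one_le_cast (α := ℝ)).2 this
      | succ K ih =>
        rw [pow_succ']
        exact (mul_le_mul_of_nonneg_left ih (by positivity)).trans (hcon K).le
    have hlim := tendsto_pow_const_div_const_pow_of_one_lt N (show (1 : ℝ) < 1 + ε by linarith)
    have hlim' := (hlim.comp (tendsto_add_atTop_nat 1)).eventually
      (gt_mem_nhds (show (0 : ℝ) < (1 + ε)⁻¹ by positivity))
    obtain ⟨K, hK⟩ := hlim'.exists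
    simp only [Function.comp_apply] at hK
    rw [div_lt_iff₀ (by positivity), pow_succ', inv_mul_cancel_left₀ (by positivity)] at hK
    have h1 : ((B K).card : ℝ) ≤ ((K + 1 : ℕ) : ℝ) ^ N := by exact_mod_cast hcard K
    exact absurd ((hlow K).trans h1) (not_le.2 hK)
  obtain ⟨K, hK⟩ := hgrowth
  refine ⟨B K, B (K + 1), ⟨1, hone K⟩, ?_, ?_, ?_, hK⟩
  · intro m hm
    obtain ⟨a, ha, rfl⟩ := (hmem _ _).1 hm
    exact (hmem _ _).2 ⟨a, fun j => (ha j).trans (by omega), rfl⟩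
  · intro m hm
    obtain ⟨a, ha, rfl⟩ := (hmem _ _).1 hm
    exact Finset.prod_ne_zero_iff.2 fun j _ => by positivity
  · intro n hn m hm
    obtain ⟨a, ha, rfl⟩ := (hmem _ _).1 hm
    rw [Finset.mem_Icc] at hn
    let i : Fin N := ⟨n - 1, by omega⟩
    refine (hmem _ _).2 ⟨a + Pi.single i 1, fun j => ?_, ?_⟩
    · have := ha j
      rcases eq_or_ne j i with rfl | h
      · simp; omega
      · simp [h]; omega
    · simp only [φ, Pi.add_apply, pow_add, Finset.prod_mul_distrib]
      rw [mul_comm]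
      congr 1
      rw [Finset.prod_eq_single i]
      · simp [i]; omega
      · intro j _ hj; simp [hj]
      · simp

/-! ### Trigonometric polynomials and Parseval's identity -/

/-- The trigonometric polynomial `∑ c_m e(m x)`. -/
noncomputable def trigPoly (A : Finset ℕ) (c : ℕ → ℂ) (x : ℝ) : ℂ :=
  ∑ m ∈ A, c m * Complex.exp (2 * Real.pi * Complex.I * m * x)

lemma continuous_trigPoly (A : Finset ℕ) (c : ℕ → ℂ) : Continuous (trigPoly A c) := by
  unfold trigPoly; fun_prop

lemma periodic_trigPoly (A : Finset ℕ) (c : ℕ → ℂ) : Function.Periodic (trigPoly A c) 1 := by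
  intro x
  refine Finset.sum_congr rfl fun m _ => ?_
  congr 1
  rw [Complex.exp_eq_exp_iff_exists_int]
  exact ⟨m, by push_cast; ring⟩

lemma integral_exp_int (k : ℤ) :
    ∫ x in (0 : ℝ)..1, Complex.exp (2 * Real.pi * Complex.I * k * x) = if k = 0 then 1 else 0 := by
  split_ifs with h
  · simp [h]
  · have hc : (2 * Real.pi * Complex.I * k : ℂ) ≠ 0 := by
      simp [h, Real.pi_ne_zero]
    rw [integral_exp_mul_complex hc]
    have : Complex.exp (2 * Real.pi * Complex.I * k) = 1 :=
      Complex.exp_eq_one_iff.2 ⟨k, by ring⟩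
    simp [this]

lemma integral_norm_sq_trigPoly (A : Finset ℕ) (c : ℕ → ℂ) :
    ∫ x in (0 : ℝ)..1, ‖trigPoly A c x‖ ^ 2 = ∑ m ∈ A, ‖c m‖ ^ 2 := by
  have h1 : ∀ x : ℝ, ((‖trigPoly A c x‖ ^ 2 : ℝ) : ℂ) = ∑ m ∈ A, ∑ m' ∈ A,
      (c m * (starRingEnd ℂ) (c m')) *
        Complex.exp (2 * Real.pi * Complex.I * ((m - m' : ℤ) : ℂ) * x) := by
    intro x
    push_cast
    rw [← Complex.mul_conj', trigPoly, map_sum, Finset.sum_mul_sum]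
    refine Finset.sum_congr rfl fun m _ => Finset.sum_congr rfl fun m' _ => ?_
    rw [map_mul, ← Complex.exp_conj, mul_mul_mul_comm, ← Complex.exp_add]
    congr 2
    simp only [map_mul, Complex.conj_I, Complex.conj_ofReal, map_natCast, map_ofNat]
    ring
  have h2 : ((∫ x in (0 : ℝ)..1, ‖trigPoly A c x‖ ^ 2 : ℝ) : ℂ) =
      ((∑ m ∈ A, ‖c m‖ ^ 2 : ℝ) : ℂ) := by
    rw [← intervalIntegral.integral_ofReal]
    simp_rw [h1]
    rw [intervalIntegral.integral_finsetSum]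
    · rw [Complex.ofReal_sum]
      refine Finset.sum_congr rfl fun m hm => ?_
      rw [intervalIntegral.integral_finsetSum]
      · simp_rw [intervalIntegral.integral_const_mul, integral_exp_int]
        rw [Finset.sum_eq_single m]
        · simp [Complex.mul_conj']
        · intro m' _ hne
          have : (m : ℤ) - m' ≠ 0 := by omega
          simp [this]
        · exact fun h => absurd hm h
      · intro m' _
        exact Continuous.intervalIntegrable (by fun_prop) _ _
    · intro m _
      exact Continuous.intervalIntegrable (by fun_prop) _ _
  exact_mod_cast h2

lemma lintegral_enorm_sq_trigPoly (A : Finset ℕ) (c : ℕ → ℂ) :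
    ∫⁻ x, ‖trigPoly A c x‖ₑ ^ 2 ∂unitMeasure = ENNReal.ofReal (∑ m ∈ A, ‖c m‖ ^ 2) := by
  rw [← integral_norm_sq_trigPoly, intervalIntegral.integral_of_le zero_le_one,
    ← Measure.restrict_congr_set (Ico_ae_eq_Ioc (μ := volume)),
    ofReal_integral_eq_lintegral_ofReal]
  · refine lintegral_congr fun x => ?_
    rw [ENNReal.ofReal_pow (norm_nonneg _), ofReal_norm]
  · exact ((continuous_trigPoly A c).norm.pow 2).integrableOn_Icc.mono_set Set.Ico_subset_Icc_self
  · exact Eventually.of_forall fun x => by positivity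

/-! ### Approximate eigenfunctions -/

/-- The completely multiplicative unimodular function `n ↦ n ^ (i θ / log 2)`. -/
noncomputable def twist (θ : ℝ) (n : ℕ) : ℂ := Complex.exp ((θ * Real.logb 2 n : ℝ) * Complex.I)

lemma norm_twist (θ : ℝ) (n : ℕ) : ‖twist θ n‖ = 1 := Complex.norm_exp_ofReal_mul_I _

lemma twist_mul (θ : ℝ) {m n : ℕ} (hm : m ≠ 0) (hn : n ≠ 0) :
    twist θ (m * n) = twist θ m * twist θ n := by
  unfold twist
  rw [← Complex.exp_add, Nat.cast_mul, Real.logb_mul (by exact_mod_cast hm) (by exact_mod_cast hn)]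
  push_cast
  ring_nf

lemma measurableSet_approxEigen {F : ℝ → ℂ} (hF : Continuous F) (N : ℕ) (θ ρ : ℝ) :
    MeasurableSet {x : ℝ | ∀ n ∈ Finset.Icc 1 N, ‖F (n * x) - twist θ n * F x‖ ≤ ρ * ‖F x‖} := by
  simp only [Set.ofPred_forall]
  exact Finset.measurableSet_biInter _ fun n _ =>
    (isClosed_le (by fun_prop) (by fun_prop)).measurableSet

/-- Approximate eigenfunctions of the operators `f ↦ f (n ·)` with eigenvalues `n ^ (i θ / log 2)`. -/
lemma exists_approx_eigenfunction (N : ℕ) (θ : ℝ) {ρ : ℝ} (hρ : 0 < ρ) :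
    ∃ F : ℝ → ℂ, Continuous F ∧ Function.Periodic F 1 ∧ ∃ a : ℝ≥0∞, a ≠ 0 ∧ a ≠ ∞ ∧
      ∫⁻ x, ‖F x‖ₑ ^ 2 ∂unitMeasure = a ∧
      a ≤ 2 * ∫⁻ x in {x | ∀ n ∈ Finset.Icc 1 N, ‖F (n * x) - twist θ n * F x‖ ≤ ρ * ‖F x‖},
        ‖F x‖ₑ ^ 2 ∂unitMeasure := by
  -- Chosen so that the `N` Chebyshev bounds, each at most `ρ⁻² * 2ε * A.card`, add up to at most
  -- half the mass `A.card`.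
  have hε : 0 < ρ ^ 2 / (4 * (N + 1)) := by positivity
  obtain ⟨A, A', hne, hsub, h0, hmul, hcard⟩ := exists_almost_invariant_finset N hε
  set c : ℕ → ℂ := fun m => (twist θ m)⁻¹ with hc
  have hcn : ∀ m, ‖c m‖ = 1 := fun m => by simp [hc, norm_twist]
  set F := trigPoly A c with hF
  have hFc : Continuous F := continuous_trigPoly A c
  have hnorm : ∫⁻ x, ‖F x‖ₑ ^ 2 ∂unitMeasure = ENNReal.ofReal A.card := by
    rw [hF, lintegral_enorm_sq_trigPoly]
    simp [hcn]
  have hdiff : ∀ n ∈ Finset.Icc 1 N,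
      ∫⁻ x, ‖F (n * x) - twist θ n * F x‖ₑ ^ 2 ∂unitMeasure ≤
        ENNReal.ofReal (2 * (A'.card - A.card)) := by
    intro n hn
    have hn0 : n ≠ 0 := by have := (Finset.mem_Icc.1 hn).1; omega
    set nA := A.image (n * ·) with hnA
    have hinj : Function.Injective (n * · : ℕ → ℕ) := fun a b h =>
      Nat.eq_of_mul_eq_mul_left (Nat.pos_of_ne_zero hn0) h
    have hnAsub : nA ⊆ A' := by
      intro m hm
      obtain ⟨k, hk, rfl⟩ := Finset.mem_image.1 hm
      exact hmul n hn k hk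
    have hnAcard : nA.card = A.card := Finset.card_image_of_injective _ hinj
    -- By multiplicativity of `twist`, the terms with frequency in both `nA` and `A` cancel exactly.
    -- What remains is unimodular on the symmetric difference, which is covered by `A' \ nA` and `A'
    -- \ A`.
    let d : ℕ → ℂ := fun m =>
      twist θ n * c m * ((if m ∈ nA then 1 else 0) - (if m ∈ A then 1 else 0))
    have hrepr : ∀ x : ℝ, F (n * x) - twist θ n * F x = trigPoly A' d x := by
      intro x
      have e1 : F (n * x) = ∑ m ∈ nA, twist θ n * c m *
          Complex.exp (2 * Real.pi * Complex.I * m * x) := by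
        rw [hnA, Finset.sum_image fun a _ b _ h => hinj h, hF, trigPoly]
        refine Finset.sum_congr rfl fun m hm => ?_
        have ht : twist θ n ≠ 0 := norm_ne_zero_iff.1 (by rw [norm_twist]; exact one_ne_zero)
        simp only [hc]
        rw [twist_mul θ hn0 (h0 m hm), mul_inv, mul_inv_cancel_left₀ ht]
        push_cast
        ring_nf
      have e2 : twist θ n * F x = ∑ m ∈ A, twist θ n * c m *
          Complex.exp (2 * Real.pi * Complex.I * m * x) := by
        rw [hF, trigPoly, Finset.mul_sum]
        exact Finset.sum_congr rfl fun m _ => by ring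
      rw [e1, e2, ← Finset.inter_eq_right.2 hnAsub, ← Finset.inter_eq_right.2 hsub,
        ← Finset.sum_ite_mem, ← Finset.sum_ite_mem, ← Finset.sum_sub_distrib, trigPoly]
      refine Finset.sum_congr rfl fun m hm => ?_
      simp only [d]
      split_ifs <;> ring
    simp_rw [hrepr]
    rw [lintegral_enorm_sq_trigPoly]
    refine ENNReal.ofReal_le_ofReal ?_
    have hd : ∀ m ∈ A', ‖d m‖ ^ 2 ≤
        (1 - if m ∈ nA then (1 : ℝ) else 0) + (1 - if m ∈ A then (1 : ℝ) else 0) := by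
      intro m _
      simp only [d, norm_mul, norm_twist, hcn]
      split_ifs <;> simp
    refine (Finset.sum_le_sum hd).trans (le_of_eq ?_)
    rw [Finset.sum_add_distrib, Finset.sum_sub_distrib, Finset.sum_sub_distrib,
      Finset.sum_ite_mem, Finset.sum_ite_mem, Finset.inter_eq_right.2 hnAsub,
      Finset.inter_eq_right.2 hsub]
    simp only [Finset.sum_const, nsmul_eq_mul, mul_one, hnAcard]
    ring
  refine ⟨F, hFc, periodic_trigPoly A c, ENNReal.ofReal A.card, by simpa using hne.ne_empty,
    ENNReal.ofReal_ne_top, hnorm, ?_⟩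
  set G : Set ℝ := {x | ∀ n ∈ Finset.Icc 1 N, ‖F (n * x) - twist θ n * F x‖ ≤ ρ * ‖F x‖} with hG
  have hGm : MeasurableSet G := measurableSet_approxEigen hFc N θ ρ
  have hbad : ∫⁻ x in Gᶜ, ‖F x‖ₑ ^ 2 ∂unitMeasure ≤ ENNReal.ofReal (A.card / 2) := by
    calc ∫⁻ x in Gᶜ, ‖F x‖ₑ ^ 2 ∂unitMeasure
        ≤ ∫⁻ x in Gᶜ, ∑ n ∈ Finset.Icc 1 N, ENNReal.ofReal (ρ⁻¹ ^ 2) *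
            ‖F (n * x) - twist θ n * F x‖ₑ ^ 2 ∂unitMeasure := by
          refine setLIntegral_mono' hGm.compl fun x hx => ?_
          simp only [hG, Set.mem_compl_iff, Set.mem_ofPred_eq, not_forall, not_le] at hx
          obtain ⟨n, hn, hlt⟩ := hx
          refine le_trans ?_ (Finset.single_le_sum (fun _ _ => zero_le) hn)
          rw [← ofReal_norm, ← ofReal_norm, ← ENNReal.ofReal_pow (norm_nonneg _),
            ← ENNReal.ofReal_pow (norm_nonneg _), ← ENNReal.ofReal_mul (by positivity),
            ← mul_pow]
          refine ENNReal.ofReal_le_ofReal (pow_le_pow_left₀ (norm_nonneg _) ?_ 2)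
          rw [le_inv_mul_iff₀ hρ]
          exact hlt.le
      _ ≤ ∫⁻ x, ∑ n ∈ Finset.Icc 1 N, ENNReal.ofReal (ρ⁻¹ ^ 2) *
            ‖F (n * x) - twist θ n * F x‖ₑ ^ 2 ∂unitMeasure := setLIntegral_le_lintegral _ _
      _ = ∑ n ∈ Finset.Icc 1 N, ENNReal.ofReal (ρ⁻¹ ^ 2) *
            ∫⁻ x, ‖F (n * x) - twist θ n * F x‖ₑ ^ 2 ∂unitMeasure := by
          rw [lintegral_finsetSum]
          · refine Finset.sum_congr rfl fun n _ => ?_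
            rw [lintegral_const_mul]
            exact (Continuous.enorm (by fun_prop)).measurable.pow_const 2
          · intro n _
            exact ((Continuous.enorm (by fun_prop)).measurable.pow_const 2).const_mul _
      _ ≤ ∑ n ∈ Finset.Icc 1 N, ENNReal.ofReal (ρ⁻¹ ^ 2) *
            ENNReal.ofReal (2 * (A'.card - A.card)) := by
          gcongr with n hn
          exact hdiff n hn
      _ ≤ ENNReal.ofReal (A.card / 2) := by
          rw [Finset.sum_const, nsmul_eq_mul, Nat.card_Icc, Nat.add_sub_cancel,
            ← ENNReal.ofReal_mul (by positivity), ← ENNReal.ofReal_natCast,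
            ← ENNReal.ofReal_mul (by positivity)]
          refine ENNReal.ofReal_le_ofReal ?_
          have h1 : (A'.card : ℝ) - A.card ≤ ρ ^ 2 / (4 * (N + 1)) * A.card := by linarith
          calc (N : ℝ) * (ρ⁻¹ ^ 2 * (2 * ((A'.card : ℝ) - A.card)))
              ≤ (N + 1) * (ρ⁻¹ ^ 2 * (2 * (ρ ^ 2 / (4 * (N + 1)) * (A.card : ℝ)))) := by
                have : 0 ≤ ρ⁻¹ ^ 2 * (2 * (ρ ^ 2 / (4 * (N + 1)) * A.card)) := by positivity
                have h2 : ρ⁻¹ ^ 2 * (2 * ((A'.card : ℝ) - A.card)) ≤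
                  ρ⁻¹ ^ 2 * (2 * (ρ ^ 2 / (4 * (N + 1)) * A.card)) := by gcongr
                linarith [mul_le_mul_of_nonneg_left h2 (Nat.cast_nonneg (α := ℝ) N)]
            _ = (A.card : ℝ) / 2 := by field_simp; norm_num
  have hsplit := lintegral_add_compl (μ := unitMeasure) (fun x => ‖F x‖ₑ ^ 2) hGm
  rw [hnorm] at hsplit
  have hhalf : ENNReal.ofReal A.card =
      ENNReal.ofReal (A.card / 2) + ENNReal.ofReal (A.card / 2) := by
    rw [← ENNReal.ofReal_add (by positivity) (by positivity)]; congr 1; ring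
  have hle : ENNReal.ofReal (A.card / 2) ≤ ∫⁻ x in G, ‖F x‖ₑ ^ 2 ∂unitMeasure := by
    refine (ENNReal.add_le_add_iff_right (ENNReal.ofReal_ne_top (r := A.card / 2))).1 ?_
    rw [← hhalf, ← hsplit]
    gcongr
  rw [hhalf, two_mul]
  gcongr

/-! ### Sets with large averages at many scales -/

lemma norm_exp_sub_exp (a b : ℝ) :
    ‖Complex.exp (a * Complex.I) - Complex.exp (b * Complex.I)‖ = ‖2 * Real.sin ((a - b) / 2)‖ := by
  rw [← Complex.norm_exp_I_mul_ofReal_sub_one]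
  have h : Complex.exp (a * Complex.I) - Complex.exp (b * Complex.I) =
      Complex.exp (b * Complex.I) * (Complex.exp (Complex.I * (a - b : ℝ)) - 1) := by
    rw [mul_sub, ← Complex.exp_add, mul_one]
    push_cast
    ring_nf
  rw [h, norm_mul, Complex.norm_exp_ofReal_mul_I, one_mul]

lemma norm_exp_sub_exp_le (a b : ℝ) :
    ‖Complex.exp (a * Complex.I) - Complex.exp (b * Complex.I)‖ ≤ |a - b| := by
  rw [norm_exp_sub_exp, norm_mul, Real.norm_eq_abs, Real.norm_eq_abs]
  have := Real.abs_sin_le_abs (x := (a - b) / 2)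
  rw [abs_div] at this
  norm_num at this ⊢
  linarith

lemma le_norm_exp_sub_exp {a b : ℝ} (h : |a - b| ≤ 1) :
    |a - b| / 2 ≤ ‖Complex.exp (a * Complex.I) - Complex.exp (b * Complex.I)‖ := by
  wlog hab : b ≤ a generalizing a b
  · rw [abs_sub_comm, norm_sub_rev]
    exact this (by rwa [abs_sub_comm]) (le_of_not_ge hab)
  rw [abs_of_nonneg (sub_nonneg.2 hab)] at h ⊢
  rw [norm_exp_sub_exp]
  have h1 := Real.mul_le_sin (x := (a - b) / 2) (by linarith)
    (by linarith [Real.pi_gt_three])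
  have h2 : 1 / 2 ≤ 2 / Real.pi := by
    rw [div_le_div_iff₀ two_pos Real.pi_pos]; linarith [Real.pi_le_four]
  have h3 : (1 / 2) * ((a - b) / 2) ≤ 2 / Real.pi * ((a - b) / 2) :=
    mul_le_mul_of_nonneg_right h2 (by linarith)
  exact le_trans (by linarith) (le_abs_self _)

lemma periodic_mulMod {F : ℝ → ℂ} (hF : Function.Periodic F 1) (n : ℕ) (x : ℝ) :
    F (mulMod n x) = F (n * x) := by
  have := hF.sub_int_mul_eq ⌊(n : ℝ) * x⌋ (x := n * x)
  rwa [mul_one] at this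

/-- The set where one of the averages `A_t 1_E`, `t ∈ S`, is at least `1 / 2`. -/
def largeAverageSet (S : Finset ℕ) (E : Set ℝ) : Set ℝ :=
  {x | ∃ t ∈ S, (2 : ℝ) ^ t / 2 ≤ khintchineSum (E.indicator 1) (2 ^ t) x}

lemma le_khintchineSum_indicator {E : Set ℝ} {t : ℕ} {x : ℝ}
    (h : ∀ n : ℕ, 2 ^ t < 2 * n → n ≤ 2 ^ t → mulMod n x ∈ E) :
    (2 : ℝ) ^ t / 2 ≤ khintchineSum (E.indicator 1) (2 ^ t) x := by
  have hsub : Finset.Ioc (2 ^ t / 2) (2 ^ t) ⊆ Finset.Icc 1 (2 ^ t) := by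
    intro n hn
    rw [Finset.mem_Ioc] at hn
    exact Finset.mem_Icc.2 ⟨by omega, hn.2⟩
  calc (2 : ℝ) ^ t / 2 ≤ ((Finset.Ioc (2 ^ t / 2) (2 ^ t)).card : ℝ) := by
        rw [Nat.card_Ioc, div_le_iff₀ two_pos]
        have : 2 ^ t ≤ (2 ^ t - 2 ^ t / 2) * 2 := by omega
        exact_mod_cast this
    _ = ∑ n ∈ Finset.Ioc (2 ^ t / 2) (2 ^ t), E.indicator 1 (mulMod n x) := by
        rw [Finset.card_eq_sum_ones, Nat.cast_sum]
        refine Finset.sum_congr rfl fun n hn => ?_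
        rw [Finset.mem_Ioc] at hn
        rw [Set.indicator_of_mem (h n (by omega) hn.2)]
        simp
    _ ≤ _ := Finset.sum_le_sum_of_subset_of_nonneg hsub fun n _ _ =>
        Set.indicator_nonneg (fun _ _ => zero_le_one) _

/-- The averages over `n ≤ 2 ^ t`, `t ∈ S`, of the indicator of a suitable set are large on
essentially disjoint sets. -/
lemma exists_largeAverageSet {S : Finset ℕ} (hS : S.Nonempty) :
    ∃ E : Set ℝ, MeasurableSet E ∧
      (S.card : ℝ≥0∞) * unitMeasure E < 400 * unitMeasure (largeAverageSet S E) := by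
  obtain ⟨T, hT⟩ : ∃ T, ∀ t ∈ S, t ≤ T := ⟨S.sup id, fun t ht => Finset.le_sup (f := id) ht⟩
  -- The angles `θ t`, `t ≤ T`, stay in an interval shorter than `1`, so they do not wrap around.
  -- Distinct `ω t` are then at least `θ / 2 = 2ρ` apart, which makes discs of relative radius `ρ`
  -- disjoint.
  set θ : ℝ := 1 / (T + 1) with hθ
  have hθ0 : 0 < θ := by positivity
  have hθ1 : θ ≤ 1 := by rw [hθ, div_le_one (by positivity)]; linarith [T.cast_nonneg (α := ℝ)]
  set ρ : ℝ := θ / 4 with hρ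
  have hρ0 : 0 < ρ := by positivity
  obtain ⟨F, hF, hper, a, ha0, ha, hnorm, hG⟩ := exists_approx_eigenfunction (2 ^ T) θ hρ0
  have hGm := measurableSet_approxEigen hF (2 ^ T) θ ρ
  set G := {x : ℝ | ∀ n ∈ Finset.Icc (1 : ℕ) (2 ^ T), ‖F (n * x) - twist θ n * F x‖ ≤ ρ * ‖F x‖}
  let ω : ℕ → ℂ := fun t => Complex.exp ((θ * t : ℝ) * Complex.I)
  -- The three errors are `ρ` (`z` to `ω t * F x`), `4ρ = θ` (variation of `twist` over a block) and
  -- `ρ` (eigenfunction error). Their total `6ρ ‖F x‖` is at most `12ρ ‖F (n x)‖`, since `‖F (n x)‖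
  -- ≥ ‖F x‖ / 2`.
  let Q : Set (ℝ × ℂ) := {q | ‖q.2 - F q.1‖ < 12 * ρ * ‖F q.1‖}
  let R : ℕ → Set (ℝ × ℂ) := fun t => {q | ‖q.2 - ω t * F q.1‖ < ρ * ‖F q.1‖}
  let V : Set (ℝ × ℂ) := (Prod.fst ⁻¹' G) ∩ ⋃ t ∈ S, R t
  have hQm : MeasurableSet Q := (isOpen_lt (by fun_prop) (by fun_prop)).measurableSet
  have hRm : ∀ t, MeasurableSet (R t) := fun t =>
    (isOpen_lt (by fun_prop) (by fun_prop)).measurableSet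
  have hVm : MeasurableSet V :=
    (measurable_fst hGm).inter (Finset.measurableSet_biUnion _ fun t _ => hRm t)
  have hsub : ∀ z, (fun x => (x, z)) ⁻¹' V ⊆ largeAverageSet S ((fun x => (x, z)) ⁻¹' Q) := by
    rintro z x ⟨hxG, hx⟩
    simp only [Set.mem_iUnion] at hx
    obtain ⟨t, ht, hxt⟩ := hx
    refine ⟨t, ht, le_khintchineSum_indicator fun n hn1 hn2 => ?_⟩
    have hn0 : 1 ≤ n := by have := Nat.pow_pos (n := t) two_pos; omega
    have hxt' : ‖z - ω t * F x‖ < ρ * ‖F x‖ := hxt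
    have hgood : ‖F (n * x) - twist θ n * F x‖ ≤ ρ * ‖F x‖ :=
      hxG n (Finset.mem_Icc.2 ⟨hn0, hn2.trans (Nat.pow_le_pow_right two_pos (hT t ht))⟩)
    change ‖z - F (mulMod n x)‖ < 12 * ρ * ‖F (mulMod n x)‖
    rw [periodic_mulMod hper]
    have hn0' : (0 : ℝ) < n := by exact_mod_cast hn0
    have hlog1 : Real.logb 2 n ≤ t := by
      rw [Real.logb_le_iff_le_rpow one_lt_two hn0', Real.rpow_natCast]
      exact_mod_cast hn2
    have hlog2 : (t : ℝ) - 1 ≤ Real.logb 2 n := by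
      rw [Real.le_logb_iff_rpow_le one_lt_two hn0', Real.rpow_sub two_pos, Real.rpow_natCast,
        Real.rpow_one, div_le_iff₀ two_pos]
      have : 2 ^ t ≤ n * 2 := by omega
      exact_mod_cast this
    have htw : ‖ω t * F x - twist θ n * F x‖ ≤ 4 * ρ * ‖F x‖ := by
      rw [← sub_mul, norm_mul]
      refine mul_le_mul_of_nonneg_right ((norm_exp_sub_exp_le _ _).trans ?_) (norm_nonneg _)
      rw [← mul_sub, abs_mul, abs_of_pos hθ0, abs_of_nonneg (by linarith)]
      have : θ * (t - Real.logb 2 n) ≤ θ * 1 := by gcongr; linarith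
      linarith
    have hFn : ‖F x‖ / 2 ≤ ‖F (n * x)‖ := by
      have h1 : ‖twist θ n * F x‖ = ‖F x‖ := by rw [norm_mul, norm_twist, one_mul]
      have h2 := norm_sub_norm_le (twist θ n * F x) (F (n * x))
      rw [h1, norm_sub_rev] at h2
      have h3 : ρ * ‖F x‖ ≤ 1 / 2 * ‖F x‖ := by gcongr; linarith
      linarith
    calc ‖z - F (n * x)‖
        = ‖(z - ω t * F x) + (ω t * F x - twist θ n * F x) - (F (n * x) - twist θ n * F x)‖ := by
          congr 1; ring
      _ ≤ ‖z - ω t * F x‖ + ‖ω t * F x - twist θ n * F x‖ + ‖F (n * x) - twist θ n * F x‖ :=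
          (norm_sub_le _ _).trans (by gcongr; exact norm_add_le _ _)
      _ < ρ * ‖F x‖ + 4 * ρ * ‖F x‖ + ρ * ‖F x‖ := by linarith
      _ ≤ 12 * ρ * ‖F (n * x)‖ := by nlinarith
  -- If every slice of `Q` failed, integrating over `z` would bound `V` by `Q`. Fubini in the other
  -- order contradicts this: `Q` has measure `144 b a`, while `V` has at least `S.card * b * a / 2`.
  by_contra! hcon
  have key : 400 * (unitMeasure.prod volume) V ≤ S.card * (unitMeasure.prod volume) Q := by
    rw [Measure.prod_apply_symm hVm, Measure.prod_apply_symm hQm,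
      ← lintegral_const_mul _ (measurable_measure_prodMk_right hVm),
      ← lintegral_const_mul _ (measurable_measure_prodMk_right hQm)]
    refine lintegral_mono fun z => ?_
    refine le_trans ?_ (hcon _ (measurable_prodMk_right hQm))
    gcongr
    exact hsub z
  set b : ℝ≥0∞ := ENNReal.ofReal ρ ^ 2 * NNReal.pi with hb
  have hb0 : b ≠ 0 := by
    simp [hb, hρ0, NNReal.pi_ne_zero]
  have hbtop : b ≠ ∞ :=
    ENNReal.mul_ne_top (ENNReal.pow_ne_top ENNReal.ofReal_ne_top) ENNReal.coe_ne_top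
  have hball : ∀ (w v : ℂ) (k : ℝ), 0 ≤ k → volume {z : ℂ | ‖z - w‖ < k * ρ * ‖v‖} =
      ENNReal.ofReal k ^ 2 * b * ‖v‖ₑ ^ 2 := by
    intro w v k hk
    have : {z : ℂ | ‖z - w‖ < k * ρ * ‖v‖} = Metric.ball w (k * ρ * ‖v‖) := by
      ext z; simp [dist_eq_norm]
    rw [this, Complex.volume_ball, ENNReal.ofReal_mul (by positivity), ENNReal.ofReal_mul hk,
      ofReal_norm, hb]
    ring
  have hQ : (unitMeasure.prod volume) Q = 144 * b * a := by
    rw [Measure.prod_apply hQm, ← hnorm, ← lintegral_const_mul _ (by fun_prop)]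
    refine lintegral_congr fun x => ?_
    refine (hball (F x) (F x) 12 (by norm_num)).trans ?_
    norm_num
  have hV : S.card * b * a ≤ 2 * (unitMeasure.prod volume) V := by
    rw [Measure.prod_apply hVm]
    calc S.card * b * a ≤ S.card * b * (2 * ∫⁻ x in G, ‖F x‖ₑ ^ 2 ∂unitMeasure) := by gcongr
      _ = 2 * ∫⁻ x in G, S.card * b * ‖F x‖ₑ ^ 2 ∂unitMeasure := by
          rw [lintegral_const_mul _ (by fun_prop)]; ring
      _ ≤ 2 * ∫⁻ x in G, volume (Prod.mk x ⁻¹' V) ∂unitMeasure := by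
          gcongr 2 * ?_
          refine setLIntegral_mono' hGm fun x hx => ?_
          have hpre : Prod.mk x ⁻¹' V = ⋃ t ∈ S, {z : ℂ | ‖z - ω t * F x‖ < 1 * ρ * ‖F x‖} := by
            ext z
            simp [V, R, hx]
          rw [hpre, measure_biUnion_finset]
          · simp_rw [hball _ (F x) 1 zero_le_one]
            simp [mul_assoc]
          · intro s hs t ht hst
            refine Set.disjoint_left.2 fun z hz hz' => ?_
            simp only [Set.mem_ofPred_eq, one_mul] at hz hz'
            have h1 : ‖ω s * F x - ω t * F x‖ < 2 * ρ * ‖F x‖ := by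
              calc ‖ω s * F x - ω t * F x‖ = ‖(z - ω t * F x) - (z - ω s * F x)‖ := by
                    congr 1; ring
                _ ≤ ‖z - ω t * F x‖ + ‖z - ω s * F x‖ := norm_sub_le _ _
                _ < 2 * ρ * ‖F x‖ := by linarith
            have h2 : θ ≤ |θ * s - θ * t| := by
              rw [← mul_sub, abs_mul, abs_of_pos hθ0]
              refine le_mul_of_one_le_right hθ0.le ?_
              have : (1 : ℤ) ≤ |(s : ℤ) - t| := Int.one_le_abs (by omega)
              exact_mod_cast this
            have h3 : |θ * s - θ * t| ≤ 1 := by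
              rw [← mul_sub, abs_mul, abs_of_pos hθ0, hθ, one_div_mul_eq_div,
                div_le_one (by positivity), abs_le]
              have hs' : (s : ℝ) ≤ T := by exact_mod_cast hT s hs
              have ht' : (t : ℝ) ≤ T := by exact_mod_cast hT t ht
              have hs0 := s.cast_nonneg (α := ℝ)
              have ht0 := t.cast_nonneg (α := ℝ)
              constructor <;> linarith
            have h4 : 2 * ρ ≤ ‖ω s - ω t‖ := le_trans (by linarith) (le_norm_exp_sub_exp h3)
            rw [← sub_mul, norm_mul] at h1
            have h5 : 2 * ρ * ‖F x‖ ≤ ‖ω s - ω t‖ * ‖F x‖ := by gcongr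
            linarith
          · intro t _
            exact (isOpen_lt (by fun_prop) (by fun_prop)).measurableSet
      _ ≤ 2 * ∫⁻ x, volume (Prod.mk x ⁻¹' V) ∂unitMeasure := by
          gcongr
          exact Measure.restrict_le_self
  have hfin : 200 * (S.card * b * a) ≤ 144 * (S.card * b * a) := by
    calc 200 * (S.card * b * a) ≤ 200 * (2 * (unitMeasure.prod volume) V) := by gcongr
      _ = 400 * (unitMeasure.prod volume) V := by rw [← mul_assoc]; norm_num
      _ ≤ S.card * (144 * b * a) := hQ ▸ key
      _ = 144 * (S.card * b * a) := by ring
  have hpos : (S.card : ℝ≥0∞) * b * a ≠ 0 :=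
    mul_ne_zero (mul_ne_zero (by simpa using hS.ne_empty) hb0) ha0
  have htop : (S.card : ℝ≥0∞) * b * a ≠ ∞ :=
    ENNReal.mul_ne_top (ENNReal.mul_ne_top (ENNReal.natCast_ne_top _) hbtop) ha
  rw [ENNReal.mul_le_mul_iff_left hpos htop] at hfin
  norm_num at hfin

/-! ### Failure of the weak maximal inequality -/

/-- Level sets of the weights may be infinite, whereas the construction of `E` needs finitely many
scales. -/
lemma exists_finset_of_lt_mul_count_rpow {s : Set ℕ} {p : ℝ} (hp : 0 < p) {a : ℝ≥0∞} {y : ℝ≥0}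
    (h : a < y * Measure.count s ^ (1 / p)) :
    ∃ S : Finset ℕ, (S : Set ℕ) ⊆ s ∧ S.Nonempty ∧ a < y * (S.card : ℝ≥0∞) ^ (1 / p) := by
  have hne : (y : ℝ≥0∞) ≠ 0 := by
    rintro h0
    simp [h0] at h
  have key : ∀ c : ℝ≥0∞, a < y * c ^ (1 / p) ↔ (a / y) ^ p < c := by
    intro c
    rw [mul_comm, ← ENNReal.div_lt_iff (Or.inl hne) (Or.inl ENNReal.coe_ne_top), one_div,
      ENNReal.lt_rpow_inv_iff hp]
  rw [key] at h
  have hex : ∃ S : Finset ℕ, (S : Set ℕ) ⊆ s ∧ (a / y) ^ p < S.card := by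
    by_cases hs : s.Finite
    · refine ⟨hs.toFinset, by simp, ?_⟩
      rwa [← Measure.count_apply_finite]
    · obtain ⟨n, hn⟩ := ENNReal.exists_nat_gt h.ne_top
      obtain ⟨S, hS, rfl⟩ := Set.Infinite.exists_subset_card_eq hs n
      exact ⟨S, hS, hn⟩
  obtain ⟨S, hS, hlt⟩ := hex
  refine ⟨S, hS, ?_, (key _).2 hlt⟩
  rw [← Finset.card_pos, Nat.pos_iff_ne_zero]
  rintro h0
  simp [h0] at hlt

lemma ofReal_le_abs_of_le {a : ℝ} {z : EReal} (h : (a : EReal) ≤ z) :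
    ENNReal.ofReal a ≤ z.abs := by
  induction z with
  | bot => simp at h
  | top => simp
  | coe z =>
    rw [EReal.abs_def]
    exact ENNReal.ofReal_le_ofReal ((EReal.coe_le_coe_iff.1 h).trans (le_abs_self z))

lemma dyadicAverage_khintchineOp_coeFn {p : ℝ} {f : Lp ℝ (ENNReal.ofReal p) unitMeasure}
    {g : ℝ → ℝ} (hfg : f =ᵐ[unitMeasure] g) (t : ℕ) :
    dyadicAverage (khintchineOp p) t f =ᵐ[unitMeasure]
      fun x => ((2 : ℝ) ^ t)⁻¹ * khintchineSum g (2 ^ t) x := by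
  have h1 : ∀ᵐ x ∂unitMeasure, ∀ n : ℕ+, khintchineOp p n f x = g (mulMod n x) := by
    rw [ae_all_iff]
    intro n
    filter_upwards [khintchineOp_coeFn p n f,
      (measurePreserving_mulMod n.ne_zero).quasiMeasurePreserving.ae_eq_comp hfg] with x h1 h2
    exact h1.trans h2
  filter_upwards [h1, Lp.coeFn_smul ((2 : ℝ) ^ t)⁻¹
    (∑ n ∈ Finset.Icc (1 : ℕ+) (2 ^ t), khintchineOp p n f),
    Lp.coeFn_finsetSum (Finset.Icc (1 : ℕ+) (2 ^ t)) (fun n => khintchineOp p n f)]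
    with x hx h2 h3
  rw [dyadicAverage, h2, Pi.smul_apply, h3, smul_eq_mul]
  congr 1
  rw [Finset.sum_apply]
  refine Finset.sum_nbij (fun n : ℕ+ => (n : ℕ)) ?_ (fun a _ b _ h => PNat.coe_injective h) ?_
    fun n _ => hx n
  · intro n hn
    rw [Finset.mem_Icc] at hn ⊢
    exact ⟨n.pos, by exact_mod_cast hn.2⟩
  · intro n hn
    rw [Finset.coe_Icc, Set.mem_Icc] at hn
    refine ⟨n.toPNat hn.1, ?_, rfl⟩
    rw [Finset.coe_Icc, Set.mem_Icc]
    refine ⟨one_le, ?_⟩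
    rw [← PNat.coe_le_coe, PNat.pow_coe]
    exact hn.2

/-- With `w ≥ y` on `S`, the maximal function of `1_E` is at least `y / 2` on the large set. The
inequality would then force `y * S.card ^ (1/p) ≤ 2 * C * 400 ^ (1/p)`, which `C_p(w) = ∞` rules out
for suitable `y` and `S`. -/
theorem ultimatelyBad_khintchineOp {p : ℝ} (hp : 1 < p) : UltimatelyBad (khintchineOp p) := by
  rintro w hw hwC ⟨C, -, hC⟩
  have hp0 : 0 < p := one_pos.trans hp
  have hq : 0 < 1 / p := by positivity
  have hA : (2 * C * 400 ^ (1 / p) : ℝ≥0∞) < weightConst p w := by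
    rw [hwC]
    exact ENNReal.mul_lt_top (by finiteness) (ENNReal.rpow_lt_top_of_nonneg hq.le (by simp))
  obtain ⟨y, hy⟩ := lt_iSup_iff.1 hA
  obtain ⟨S, hSw, hS, hyS⟩ := exists_finset_of_lt_mul_count_rpow hp0 hy
  obtain ⟨E, hEm, hE⟩ := exists_largeAverageSet hS
  set B := largeAverageSet S E
  have hwy : ∀ t ∈ S, (y : ℝ) ≤ w t := by
    intro t ht
    have := hSw ht
    simpa [EReal.abs_def, abs_of_pos (hw t), ENNReal.le_ofReal_iff_toReal_le, (hw t).le] using this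
  let f : Lp ℝ (ENNReal.ofReal p) unitMeasure := indicatorConstLp _ hEm (measure_ne_top _ E) 1
  have hf : f =ᵐ[unitMeasure] E.indicator 1 := indicatorConstLp_coeFn
  have hnorm : eLpNorm f (ENNReal.ofReal p) unitMeasure = unitMeasure E ^ (1 / p) := by
    rw [eLpNorm_congr_ae hf]
    change eLpNorm (E.indicator fun _ => (1 : ℝ)) _ _ = _
    rw [eLpNorm_indicator_const hEm (by simpa using hp0) ENNReal.ofReal_ne_top,
      ENNReal.toReal_ofReal hp0.le, enorm_one, one_mul]
  have hBle : unitMeasure B ≤ unitMeasure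
      {x | ((y / 2 : ℝ≥0) : ℝ≥0∞) ≤ (weightedMaximal (khintchineOp p) w f x).abs} := by
    refine measure_mono_ae ?_
    filter_upwards [ae_all_iff.2 fun t => dyadicAverage_khintchineOp_coeFn hf t] with x hx hxB
    obtain ⟨t, ht, hlarge⟩ := hxB
    have h1 : (y / 2 : ℝ) ≤ w t * dyadicAverage (khintchineOp p) t f x := by
      rw [hx t]
      have h2 : 1 / 2 ≤ ((2 : ℝ) ^ t)⁻¹ * khintchineSum (E.indicator 1) (2 ^ t) x := by
        rw [le_inv_mul_iff₀ (by positivity)]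
        linarith
      calc (y / 2 : ℝ) = y * (1 / 2) := by ring
        _ ≤ _ := mul_le_mul (hwy t ht) h2 (by norm_num) (hw t).le
    have h3 : ((y / 2 : ℝ) : EReal) ≤ weightedMaximal (khintchineOp p) w f x :=
      (EReal.coe_le_coe_iff.2 h1).trans (le_iSup (fun t : ℕ =>
        ((w t * dyadicAverage (khintchineOp p) t f x : ℝ) : EReal)) t)
    have h4 := ofReal_le_abs_of_le h3
    change ((y / 2 : ℝ≥0) : ℝ≥0∞) ≤ _
    convert h4
    rw [← NNReal.coe_two, ← NNReal.coe_div, ENNReal.ofReal_coe_nnreal]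
  have hB0 : unitMeasure B ≠ 0 := by
    rintro h0
    simp [h0] at hE
  have hweak : (y / 2 : ℝ≥0) * unitMeasure B ^ (1 / p) ≤ C * unitMeasure E ^ (1 / p) := by
    rw [← hnorm]
    refine le_trans ?_ ((le_iSup _ (y / 2)).trans (hC f))
    gcongr
  have hfin : (y / 2 : ℝ≥0) * (S.card : ℝ≥0∞) ^ (1 / p) * unitMeasure B ^ (1 / p) ≤
      C * 400 ^ (1 / p) * unitMeasure B ^ (1 / p) := by
    calc (y / 2 : ℝ≥0) * (S.card : ℝ≥0∞) ^ (1 / p) * unitMeasure B ^ (1 / p)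
        = (S.card : ℝ≥0∞) ^ (1 / p) * ((y / 2 : ℝ≥0) * unitMeasure B ^ (1 / p)) := by ring
      _ ≤ (S.card : ℝ≥0∞) ^ (1 / p) * (C * unitMeasure E ^ (1 / p)) := by gcongr
      _ = C * ((S.card : ℝ≥0∞) * unitMeasure E) ^ (1 / p) := by
          rw [ENNReal.mul_rpow_of_nonneg _ _ hq.le]; ring
      _ ≤ C * (400 * unitMeasure B) ^ (1 / p) := by gcongr
      _ = _ := by rw [ENNReal.mul_rpow_of_nonneg _ _ hq.le]; ring
  rw [ENNReal.mul_le_mul_iff_left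
    (ENNReal.rpow_pos (pos_iff_ne_zero.2 hB0) (measure_ne_top _ _)).ne'
    (ENNReal.rpow_ne_top_of_nonneg hq.le (measure_ne_top _ _))] at hfin
  refine absurd hyS (not_lt.2 ?_)
  calc y * (S.card : ℝ≥0∞) ^ (1 / p) = 2 * ((y / 2 : ℝ≥0) * (S.card : ℝ≥0∞) ^ (1 / p)) := by
        rw [← mul_assoc]
        congr 1
        rw [ENNReal.coe_div two_ne_zero, ENNReal.coe_ofNat,
          ENNReal.mul_div_cancel two_ne_zero ENNReal.ofNat_ne_top]
    _ ≤ 2 * (C * 400 ^ (1 / p)) := by gcongr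
    _ = _ := by ring

/-! ### Mixing of the multiplication maps -/

open AddCircle in
lemma measurePreserving_nsmul_haarAddCircle (k : ℕ) :
    MeasurePreserving (fun y : UnitAddCircle => (k + 2) • y) haarAddCircle haarAddCircle := by
  have h : (volume : Measure UnitAddCircle) = haarAddCircle := by
    rw [volume_eq_smul_haarAddCircle]; simp
  rw [← h]
  exact (ergodic_nsmul (by omega)).toMeasurePreserving

open AddCircle in
/-- The endomorphisms `y ↦ n y` of the circle are mixing as `n → ∞`. -/
lemma tendsto_inner_compMeasurePreserving_nsmul (u v : Lp ℂ 2 (haarAddCircle (T := (1 : ℝ)))) :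
    Tendsto (fun k : ℕ =>
      inner ℂ (Lp.compMeasurePreserving _ (measurePreserving_nsmul_haarAddCircle k) v) u)
      atTop (𝓝 (inner ℂ v (fourierLp 2 0) * inner ℂ (fourierLp 2 0) u)) := by
  let K : ℕ → Lp ℂ 2 (haarAddCircle (T := (1 : ℝ))) →ₗᵢ[ℂ] Lp ℂ 2 (haarAddCircle (T := (1 : ℝ))) :=
    fun k => Lp.compMeasurePreservingₗᵢ ℂ _ (measurePreserving_nsmul_haarAddCircle k)
  let e : ℤ → Lp ℂ 2 (haarAddCircle (T := (1 : ℝ))) := fourierLp 2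
  have he : Orthonormal ℂ e := orthonormal_fourier
  change Tendsto (fun k => inner ℂ (K k v) u) atTop (𝓝 (inner ℂ v (e 0) * inner ℂ (e 0) u))
  have hK : ∀ k m, K k (e m) = e ((k + 2 : ℕ) * m) := by
    intro k m
    refine Lp.ext ?_
    have h1 := Lp.coeFn_compMeasurePreserving (e m) (measurePreserving_nsmul_haarAddCircle k)
    have h2 := (measurePreserving_nsmul_haarAddCircle k).quasiMeasurePreserving.ae_eq_comp
      (coeFn_fourierLp 2 m)
    refine h1.trans (h2.trans ?_)
    refine EventuallyEq.trans (Eventually.of_forall fun y => ?_) (coeFn_fourierLp 2 _).symm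
    simp only [Function.comp_apply, fourier_apply]
    congr 2
    rw [← natCast_zsmul, smul_smul, mul_comm]
  -- For a character `e m` with `m ≠ 0`, the images `e ((k + 2) m)` are distinct orthonormal
  -- vectors, so Bessel's inequality sends their inner products with `u` to zero. General `v` follow
  -- by density, as each `K k` is an isometry.
  have hspan : ∀ v ∈ Submodule.span ℂ (Set.range e), Tendsto (fun k => inner ℂ (K k v) u) atTop
      (𝓝 (inner ℂ v (e 0) * inner ℂ (e 0) u)) := by
    intro v hv
    induction hv using Submodule.span_induction with
    | mem v hv =>
      obtain ⟨m, rfl⟩ := hv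
      simp_rw [hK]
      rcases eq_or_ne m 0 with rfl | hm
      · simp [inner_self_eq_norm_sq_to_K, he.norm_eq_one]
      · rw [he.inner_eq_zero hm, zero_mul]
        have h0 := (he.inner_products_summable u).tendsto_cofinite_zero
        have hinj : Function.Injective fun k : ℕ => ((k + 2 : ℕ) : ℤ) * m := by
          intro a b hab
          have := mul_right_cancel₀ hm hab
          omega
        have h1 := h0.comp (Nat.cofinite_eq_atTop ▸ hinj.tendsto_cofinite)
        rw [tendsto_zero_iff_norm_tendsto_zero]
        have h2 := h1.sqrt
        simpa using h2
    | zero => simp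
    | add v w _ _ hv hw =>
      simp_rw [map_add, inner_add_left, add_mul]
      exact hv.add hw
    | smul c v _ hv =>
      simp_rw [map_smul, inner_smul_left, mul_assoc]
      exact hv.const_mul _
  rw [Metric.tendsto_atTop]
  intro ε hε
  have hδ : 0 < ε / (4 * (‖u‖ + 1)) := by positivity
  have hv : v ∈ (Submodule.span ℂ (Set.range e)).topologicalClosure := by
    rw [show (Submodule.span ℂ (Set.range e)).topologicalClosure = ⊤ from
      span_fourierLp_closure_eq_top (by simp)]
    trivial
  obtain ⟨v', hv', hvv'⟩ := Metric.mem_closure_iff.1 hv _ hδ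
  obtain ⟨N, hN⟩ := Metric.tendsto_atTop.1 (hspan v' hv') (ε / 2) (half_pos hε)
  refine ⟨N, fun k hk => ?_⟩
  have h1 := hN k hk
  rw [dist_eq_norm] at h1 hvv' ⊢
  have h2 : ‖inner ℂ (K k (v - v')) u‖ ≤ ‖v - v'‖ * ‖u‖ :=
    (norm_inner_le_norm _ _).trans_eq (by rw [LinearIsometry.norm_map])
  have h3 : ‖inner ℂ (v - v') (e 0) * inner ℂ (e 0) u‖ ≤ ‖v - v'‖ * ‖u‖ := by
    rw [norm_mul]
    have ha := norm_inner_le_norm (𝕜 := ℂ) (v - v') (e 0)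
    have hb := norm_inner_le_norm (𝕜 := ℂ) (e 0) u
    rw [he.norm_eq_one, mul_one] at ha
    rw [he.norm_eq_one, one_mul] at hb
    gcongr
  have h4 : ‖v - v'‖ * ‖u‖ ≤ ε / 4 := by
    calc ‖v - v'‖ * ‖u‖ ≤ ε / (4 * (‖u‖ + 1)) * (‖u‖ + 1) := by
          gcongr; linarith
      _ = ε / 4 := by field_simp
  calc ‖inner ℂ (K k v) u - inner ℂ v (e 0) * inner ℂ (e 0) u‖
      = ‖(inner ℂ (K k v') u - inner ℂ v' (e 0) * inner ℂ (e 0) u) +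
          inner ℂ (K k (v - v')) u - inner ℂ (v - v') (e 0) * inner ℂ (e 0) u‖ := by
        rw [map_sub, inner_sub_left, inner_sub_left]
        congr 1
        ring
    _ ≤ ‖inner ℂ (K k v') u - inner ℂ v' (e 0) * inner ℂ (e 0) u‖ +
          ‖inner ℂ (K k (v - v')) u‖ + ‖inner ℂ (v - v') (e 0) * inner ℂ (e 0) u‖ :=
        (norm_sub_le _ _).trans (by gcongr; exact norm_add_le _ _)
    _ < ε := by linarith

open AddCircle in
lemma tendsto_measureReal_inter_preimage_nsmul {U V : Set UnitAddCircle} (hU : MeasurableSet U)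
    (hV : MeasurableSet V) :
    Tendsto (fun k : ℕ => (volume : Measure UnitAddCircle).real
      ((fun y : UnitAddCircle => (k + 2) • y) ⁻¹' V ∩ U)) atTop
      (𝓝 ((volume : Measure UnitAddCircle).real V * (volume : Measure UnitAddCircle).real U)) := by
  have h : (volume : Measure UnitAddCircle) = haarAddCircle := by
    rw [volume_eq_smul_haarAddCircle]; simp
  rw [h]
  let ind : ∀ W : Set UnitAddCircle, MeasurableSet W → Lp ℂ 2 (haarAddCircle (T := (1 : ℝ))) :=
    fun W hW => indicatorConstLp 2 hW (measure_ne_top _ _) 1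
  have he : fourierLp 2 0 = ind Set.univ MeasurableSet.univ := by
    refine Lp.ext ((coeFn_fourierLp 2 0).trans (EventuallyEq.trans ?_ indicatorConstLp_coeFn.symm))
    exact Eventually.of_forall fun y => by simp
  have hinner : ∀ W W' (hW : MeasurableSet W) (hW' : MeasurableSet W'),
      inner ℂ (ind W hW) (ind W' hW') =
        (((haarAddCircle (T := (1 : ℝ))).real (W ∩ W') : ℝ) : ℂ) := fun W W' hW hW' =>
    L2.inner_indicatorConstLp_one_indicatorConstLp_one hW hW'
  have hlim := tendsto_inner_compMeasurePreserving_nsmul (ind U hU) (ind V hV)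
  rw [he, hinner, hinner, Set.inter_univ, Set.univ_inter, ← Complex.ofReal_mul] at hlim
  have hk : ∀ k, inner ℂ (Lp.compMeasurePreserving _ (measurePreserving_nsmul_haarAddCircle k)
      (ind V hV)) (ind U hU) = (((haarAddCircle (T := (1 : ℝ))).real
        ((fun y : UnitAddCircle => (k + 2) • y) ⁻¹' V ∩ U) : ℝ) : ℂ) := by
    intro k
    rw [← hinner _ _ (hV.preimage (measurePreserving_nsmul_haarAddCircle k).measurable) hU]
    congr 1
  simp_rw [hk] at hlim
  exact (Complex.continuous_re.tendsto _).comp hlim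

instance isProbabilityMeasure_unitMeasure : IsProbabilityMeasure unitMeasure := ⟨by simp⟩

lemma fract_section_nsmul (n : ℕ) (y : UnitAddCircle) :
    (AddCircle.equivIco 1 0 (n • y) : ℝ) = mulMod n (AddCircle.equivIco 1 0 y : ℝ) := by
  have h := AddCircle.coe_equivIco_mk_apply (1 : ℝ) (n * (AddCircle.equivIco 1 0 y : ℝ))
  rw [div_one, mul_one] at h
  rw [mulMod, ← h, ← nsmul_eq_mul, AddCircle.coe_nsmul, AddCircle.coe_equivIco]

lemma exists_le_measureReal_preimage_mulMod_inter {U V : Set ℝ} (hU : MeasurableSet U)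
    (hV : MeasurableSet V) (hV0 : 0 < unitMeasure.real V) :
    ∃ q ≠ 0, unitMeasure.real V * unitMeasure.real U / 2 ≤
      unitMeasure.real (mulMod q ⁻¹' V ∩ U) := by
  rcases (measureReal_nonneg (μ := unitMeasure) (s := U)).eq_or_lt with hU0 | hU0
  · exact ⟨1, one_ne_zero, by rw [← hU0]; simp⟩
  have hs := measurePreserving_fract_section
  set s : UnitAddCircle → ℝ := fun y => (AddCircle.equivIco 1 0 y : ℝ)
  have hmeas : ∀ W : Set ℝ, MeasurableSet W →
      unitMeasure.real W = (volume : Measure UnitAddCircle).real (s ⁻¹' W) := fun W hW => by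
    rw [measureReal_def, measureReal_def, hs.measure_preimage hW.nullMeasurableSet]
  have hlim := tendsto_measureReal_inter_preimage_nsmul (hU.preimage hs.measurable)
    (hV.preimage hs.measurable)
  rw [← hmeas V hV, ← hmeas U hU] at hlim
  obtain ⟨k, hk⟩ := (hlim.eventually (lt_mem_nhds (half_lt_self (mul_pos hV0 hU0)))).exists
  refine ⟨k + 2, by omega, hk.le.trans_eq ?_⟩
  rw [hmeas _ ((hV.preimage (measurePreserving_mulMod (by omega)).measurable).inter hU)]
  congr 1
  ext y
  have := fract_section_nsmul (k + 2) y
  simp only [Set.mem_inter_iff, Set.mem_preimage, s, this]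

/-! ### Spreading the large set over almost all of `[0,1)` -/

lemma mulMod_mulMod (m n : ℕ) (x : ℝ) : mulMod m (mulMod n x) = mulMod n (mulMod m x) := by
  have h : ∀ m n : ℕ, mulMod m (mulMod n x) = Int.fract (m * (n * x)) := by
    intro m n
    rw [mulMod, mulMod, Int.fract_eq_fract]
    exact ⟨-(m * ⌊(n : ℝ) * x⌋), by rw [Int.fract]; push_cast; ring⟩
  rw [h, h]
  ring_nf

lemma measurable_mulMod (n : ℕ) : Measurable (mulMod n) :=
  measurable_fract.comp (measurable_const_mul _)

lemma measurable_khintchineSum {f : ℝ → ℝ} (hf : Measurable f) (N : ℕ) :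
    Measurable (khintchineSum f N) :=
  Finset.measurable_sum _ fun n _ => hf.comp (measurable_mulMod n)

lemma measurableSet_largeAverageSet (S : Finset ℕ) {E : Set ℝ} (hE : MeasurableSet E) :
    MeasurableSet (largeAverageSet S E) := by
  have : largeAverageSet S E =
      ⋃ t ∈ S, {x | (2 : ℝ) ^ t / 2 ≤ khintchineSum (E.indicator 1) (2 ^ t) x} := by
    ext x
    simp [largeAverageSet]
  rw [this]
  exact Finset.measurableSet_biUnion _ fun t _ => measurableSet_le measurable_const
    (measurable_khintchineSum (measurable_one.indicator hE) _)

lemma largeAverageSet_mono (S : Finset ℕ) {E E' : Set ℝ} (h : E ⊆ E') :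
    largeAverageSet S E ⊆ largeAverageSet S E' := by
  rintro x ⟨t, ht, hx⟩
  exact ⟨t, ht, hx.trans (Finset.sum_le_sum fun n _ =>
    Set.indicator_le_indicator_of_subset h (fun _ => zero_le_one) _)⟩

lemma largeAverageSet_preimage_mulMod (S : Finset ℕ) (E : Set ℝ) (q : ℕ) :
    largeAverageSet S (mulMod q ⁻¹' E) = mulMod q ⁻¹' largeAverageSet S E := by
  ext x
  have h : ∀ N, khintchineSum ((mulMod q ⁻¹' E).indicator 1) N x =
      khintchineSum (E.indicator 1) N (mulMod q x) := by
    intro N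
    refine Finset.sum_congr rfl fun n _ => ?_
    rw [mulMod_mulMod n q]
    rfl
  simp only [largeAverageSet, Set.mem_preimage, Set.mem_ofPred_eq, h]

/-- Each step adds to `E'` a preimage of `E` under some `mulMod q`. By mixing, the corresponding
preimage of the large set captures at least a fraction `b / 2` of what is still uncovered, where `b`
is the measure of the large set of `E`. -/
lemma exists_measureReal_compl_largeAverageSet_le_pow (S : Finset ℕ) {E : Set ℝ}
    (hE : MeasurableSet E) (hB : 0 < unitMeasure.real (largeAverageSet S E)) (J : ℕ) :
    ∃ E' : Set ℝ, MeasurableSet E' ∧ unitMeasure.real E' ≤ J * unitMeasure.real E ∧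
      unitMeasure.real (largeAverageSet S E')ᶜ ≤
        (1 - unitMeasure.real (largeAverageSet S E) / 2) ^ J := by
  induction J with
  | zero => exact ⟨∅, MeasurableSet.empty, by simp, measureReal_le_one.trans_eq (pow_zero _).symm⟩
  | succ J ih =>
    obtain ⟨E', hE'm, hE', hJ⟩ := ih
    set b := unitMeasure.real (largeAverageSet S E)
    have hb1 : b ≤ 1 := measureReal_le_one
    have hU := (measurableSet_largeAverageSet S hE'm).compl
    obtain ⟨q, hq, hqU⟩ := exists_le_measureReal_preimage_mulMod_inter hU
      (measurableSet_largeAverageSet S hE) hB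
    have hqE : MeasurableSet (mulMod q ⁻¹' E) := measurable_mulMod q hE
    refine ⟨E' ∪ mulMod q ⁻¹' E, hE'm.union hqE, ?_, ?_⟩
    · refine (measureReal_union_le _ _).trans ?_
      have : unitMeasure.real (mulMod q ⁻¹' E) = unitMeasure.real E := by
        rw [measureReal_def, measureReal_def,
          (measurePreserving_mulMod hq).measure_preimage hE.nullMeasurableSet]
      rw [this]
      push_cast
      linarith
    · have hsub : (largeAverageSet S (E' ∪ mulMod q ⁻¹' E))ᶜ ⊆
          (largeAverageSet S E')ᶜ \ (mulMod q ⁻¹' largeAverageSet S E) := by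
        rw [← largeAverageSet_preimage_mulMod]
        intro x hx
        exact ⟨fun h => hx (largeAverageSet_mono S Set.subset_union_left h),
          fun h => hx (largeAverageSet_mono S Set.subset_union_right h)⟩
      have hdiff := measureReal_sdiff_add_inter (μ := unitMeasure) (s := (largeAverageSet S E')ᶜ)
        (measurable_mulMod q (measurableSet_largeAverageSet S hE))
      rw [Set.inter_comm] at hdiff
      calc unitMeasure.real (largeAverageSet S (E' ∪ mulMod q ⁻¹' E))ᶜ
          ≤ unitMeasure.real ((largeAverageSet S E')ᶜ \ (mulMod q ⁻¹' largeAverageSet S E)) :=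
            measureReal_mono hsub
        _ ≤ unitMeasure.real (largeAverageSet S E')ᶜ * (1 - b / 2) := by linarith
        _ ≤ (1 - b / 2) ^ J * (1 - b / 2) := by gcongr; linarith
        _ = (1 - b / 2) ^ (J + 1) := (pow_succ _ _).symm

/-- Small sets whose averages are large somewhere on `S`, except on a set of measure `δ`. -/
lemma exists_measureReal_compl_largeAverageSet_le {δ : ℝ} (hδ : 0 < δ) :
    ∃ K : ℝ, 0 < K ∧ ∀ S : Finset ℕ, S.Nonempty → ∃ E : Set ℝ, MeasurableSet E ∧
      S.card * unitMeasure.real E ≤ K ∧ unitMeasure.real (largeAverageSet S E)ᶜ ≤ δ := by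
  set l := max 0 (-Real.log δ)
  have hl : 0 ≤ l := le_max_left _ _
  have hlδ : Real.exp (-l) ≤ δ := by
    rw [← Real.le_log_iff_exp_le hδ]
    linarith [le_max_right 0 (-Real.log δ)]
  refine ⟨400 * (2 * l + 1), by positivity, fun S hS => ?_⟩
  obtain ⟨E, hEm, hE⟩ := exists_largeAverageSet hS
  have hE' : S.card * unitMeasure.real E < 400 * unitMeasure.real (largeAverageSet S E) := by
    have := (ENNReal.toReal_lt_toReal (by finiteness) (by finiteness)).2 hE
    simpa [measureReal_def] using this
  set b := unitMeasure.real (largeAverageSet S E)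
  have hb : 0 < b := by
    have : 0 ≤ S.card * unitMeasure.real E := by positivity
    linarith
  have hb1 : b ≤ 1 := measureReal_le_one
  -- About `2l / b` copies bring the complement down to `exp (-l) ≤ δ`. Since `S.card` times the
  -- measure of `E` is below `400 b`, the factor `b` cancels and the cost does not depend on `S`.
  obtain ⟨E', hE'm, hle, hpow⟩ :=
    exists_measureReal_compl_largeAverageSet_le_pow S hEm hb ⌈2 * l / b⌉₊
  have hJ1 := Nat.le_ceil (2 * l / b)
  have hJ2 := (Nat.ceil_lt_add_one (show 0 ≤ 2 * l / b by positivity)).le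
  set J := ⌈2 * l / b⌉₊
  refine ⟨E', hE'm, ?_, hpow.trans (le_trans ?_ hlδ)⟩
  · calc S.card * unitMeasure.real E' ≤ S.card * (J * unitMeasure.real E) := by gcongr
      _ = J * (S.card * unitMeasure.real E) := by ring
      _ ≤ (2 * l / b + 1) * (400 * b) := by gcongr
      _ = 400 * (2 * l + b) := by field_simp
      _ ≤ 400 * (2 * l + 1) := by gcongr
  · calc (1 - b / 2) ^ J ≤ Real.exp (-(b / 2)) ^ J := by
          gcongr
          · linarith
          · exact Real.one_sub_le_exp_neg _
      _ = Real.exp (-(J * (b / 2))) := by rw [← Real.exp_nat_mul]; ring_nf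
      _ ≤ Real.exp (-l) := by
          rw [div_le_iff₀ hb] at hJ1
          gcongr
          linarith

/-! ### Divergence at every slower rate -/

lemma eventually_rate_pow_two_le {p : ℝ} (hp : 0 < p) {M : ℕ → ℝ}
    (hM : Tendsto (fun N : ℕ => M N / (N * Real.log N ^ (1 / p))) atTop (𝓝 0)) {η : ℝ}
    (hη : 0 < η) : ∀ᶠ t : ℕ in atTop, M (2 ^ t) ≤ η * (2 ^ t * (t : ℝ) ^ (1 / p)) := by
  have h1 := (hM.comp (tendsto_pow_atTop_atTop_of_one_lt one_lt_two)).eventually (gt_mem_nhds hη)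
  filter_upwards [h1, eventually_ge_atTop 1] with t ht ht1
  have ht0 : (0 : ℝ) < t := by exact_mod_cast ht1
  have hlog2 : 0 < Real.log 2 := Real.log_pos one_lt_two
  simp only [Function.comp_apply, Nat.cast_pow, Nat.cast_ofNat, Real.log_pow] at ht
  rw [div_lt_iff₀ (by positivity)] at ht
  refine ht.le.trans ?_
  gcongr
  refine mul_le_of_le_one_right ht0.le ?_
  have := Real.log_two_lt_d9
  linarith

lemma exists_rescaled_largeAverageSet {p : ℝ} (hp : 0 < p) {M : ℕ → ℝ}
    (hM : Tendsto (fun N : ℕ => M N / (N * Real.log N ^ (1 / p))) atTop (𝓝 0)) (k : ℕ) :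
    ∃ (E : Set ℝ) (a : ℝ) (S : Finset ℕ), MeasurableSet E ∧ 0 ≤ a ∧
      a ^ p * unitMeasure.real E ≤ (1 / 2) ^ k ∧
      unitMeasure.real (largeAverageSet S E)ᶜ ≤ (1 / 2) ^ k ∧
      ∀ t ∈ S, k ≤ t ∧ (k + 1) * M (2 ^ t) ≤ a * (2 ^ t / 2) := by
  obtain ⟨K, hK, hSE⟩ := exists_measureReal_compl_largeAverageSet_le (δ := (1 / 2) ^ k)
    (by positivity)
  -- With `a = c (2n) ^ (1/p)` this gives `a ^ p = (1/2) ^ k * n / K`, which balances the bound `K /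
  -- n` on the measure of `E`. On `[n, 2n)` all `t ^ (1/p)` are at most `(2n) ^ (1/p)`, so one
  -- height serves every scale.
  set c : ℝ := ((1 / 2) ^ k / (2 * K)) ^ (1 / p)
  have hc : 0 < c := by positivity
  have hη : 0 < c / (2 * (k + 1)) := by positivity
  obtain ⟨n, hn⟩ := eventually_atTop.1 ((eventually_rate_pow_two_le hp hM hη).and
    (eventually_ge_atTop (k + 1)))
  have hkn := (hn n le_rfl).2
  have hn0 : (0 : ℝ) < n := by exact_mod_cast (by omega : 0 < n)
  obtain ⟨E, hEm, hE, hB⟩ := hSE (Finset.Ico n (2 * n)) (Finset.nonempty_Ico.2 (by omega))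
  rw [Nat.card_Ico, show 2 * n - n = n by omega] at hE
  refine ⟨E, c * (2 * n : ℝ) ^ (1 / p), Finset.Ico n (2 * n), hEm, by positivity, ?_, hB, ?_⟩
  · rw [Real.mul_rpow hc.le (by positivity), ← Real.rpow_mul (by positivity),
      ← Real.rpow_mul (by positivity), one_div_mul_cancel hp.ne', Real.rpow_one, Real.rpow_one]
    calc (1 / 2) ^ k / (2 * K) * (2 * n) * unitMeasure.real E
        = (1 / 2) ^ k / K * (n * unitMeasure.real E) := by field_simp
      _ ≤ (1 / 2) ^ k / K * K := by gcongr
      _ = (1 / 2) ^ k := by field_simp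
  · intro t ht
    rw [Finset.mem_Ico] at ht
    refine ⟨by omega, ?_⟩
    have ht2 : (t : ℝ) ≤ 2 * n := by exact_mod_cast ht.2.le
    calc (k + 1) * M (2 ^ t)
        ≤ (k + 1) * (c / (2 * (k + 1)) * (2 ^ t * (t : ℝ) ^ (1 / p))) := by
          gcongr
          exact (hn t ht.1).1
      _ ≤ (k + 1) * (c / (2 * (k + 1)) * (2 ^ t * (2 * n : ℝ) ^ (1 / p))) := by gcongr
      _ = c * (2 * n : ℝ) ^ (1 / p) * (2 ^ t / 2) := by field_simp

theorem exists_memLp_limsup_khintchineSum_eq_top {p : ℝ} (hp : 1 < p) {M : ℕ → ℝ}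
    (hMpos : ∀ N, 1 ≤ N → 0 < M N)
    (hM : Tendsto (fun N : ℕ => M N / (N * Real.log N ^ (1 / p))) atTop (𝓝 0)) :
    ∃ f : ℝ → ℝ, MemLp f (ENNReal.ofReal p) unitMeasure ∧
      ∀ᵐ x ∂unitMeasure,
        limsup (fun N : ℕ => ((khintchineSum f N x / M N : ℝ) : EReal)) atTop = ⊤ := by
  have hp0 : 0 < p := one_pos.trans hp
  choose E a S hEm ha hsmall hB hS using exists_rescaled_largeAverageSet hp0 hM
  -- For a supremum, `g ^ p` is at most the sum of the `p`-th powers of the pieces, which has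
  -- summable integrals.
  let g : ℝ → ℝ≥0∞ := fun x => ⨆ k, (E k).indicator (fun _ => ENNReal.ofReal (a k)) x
  have hgm : Measurable g := Measurable.iSup fun k => measurable_const.indicator (hEm k)
  have hgp : ∫⁻ x, g x ^ p ∂unitMeasure < ∞ := by
    have hsum : Summable fun k : ℕ => (1 / 2 : ℝ) ^ k := summable_geometric_two
    calc ∫⁻ x, g x ^ p ∂unitMeasure
        ≤ ∫⁻ x, ∑' k, (E k).indicator (fun _ => ENNReal.ofReal (a k) ^ p) x ∂unitMeasure := by
          refine lintegral_mono fun x => ?_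
          have hroot : g x ≤
              (∑' k, (E k).indicator (fun _ => ENNReal.ofReal (a k) ^ p) x) ^ p⁻¹ := by
            refine iSup_le fun k => ?_
            rw [ENNReal.le_rpow_inv_iff hp0]
            refine le_trans ?_ (ENNReal.le_tsum k)
            by_cases hx : x ∈ E k <;> simp [hx, hp0]
          rwa [ENNReal.le_rpow_inv_iff hp0] at hroot
      _ = ∑' k, ENNReal.ofReal (a k) ^ p * unitMeasure (E k) := by
          rw [lintegral_tsum fun k => (measurable_const.indicator (hEm k)).aemeasurable]
          simp_rw [lintegral_indicator_const (hEm _)]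
      _ ≤ ∑' k : ℕ, ENNReal.ofReal ((1 / 2) ^ k) := by
          refine ENNReal.tsum_le_tsum fun k => ?_
          rw [ENNReal.ofReal_rpow_of_nonneg (ha k) hp0.le,
            ← ofReal_measureReal (measure_ne_top _ _),
            ← ENNReal.ofReal_mul (Real.rpow_nonneg (ha k) p)]
          exact ENNReal.ofReal_le_ofReal (hsmall k)
      _ < ∞ := by
          rw [← ENNReal.ofReal_tsum_of_nonneg (fun k => by positivity) hsum]
          exact ENNReal.ofReal_lt_top
  refine ⟨fun x => (g x).toReal, ⟨hgm.ennreal_toReal.aestronglyMeasurable, ?_⟩, ?_⟩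
  · rw [eLpNorm_lt_top_iff_lintegral_rpow_enorm_lt_top (by simpa using hp0) ENNReal.ofReal_ne_top,
      ENNReal.toReal_ofReal hp0.le]
    refine lt_of_le_of_lt (lintegral_mono fun x => ?_) hgp
    gcongr
    rw [Real.enorm_of_nonneg ENNReal.toReal_nonneg]
    exact ENNReal.ofReal_toReal_le
  · have hfin : ∀ᵐ x ∂unitMeasure, g x < ∞ := by
      filter_upwards [ae_lt_top (hgm.pow_const p) hgp.ne] with x hx
      by_contra hcon
      rw [not_lt, top_le_iff] at hcon
      simp [hcon, hp0] at hx
    -- `toReal` sends `∞` to `0`, so `g` must be finite at every point `mulMod n x` used in the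
    -- sums.
    have hfin' : ∀ᵐ x ∂unitMeasure, ∀ n : ℕ, n ≠ 0 → g (mulMod n x) < ∞ := by
      rw [ae_all_iff]
      intro n
      by_cases hn : n = 0
      · simp [hn]
      · filter_upwards [(measurePreserving_mulMod hn).quasiMeasurePreserving.ae hfin] with x hx _
        exact hx
    have hbc : ∀ᵐ x ∂unitMeasure, ∀ᶠ k in atTop, x ∈ largeAverageSet (S k) (E k) := by
      have hsum : ∑' k, unitMeasure (largeAverageSet (S k) (E k))ᶜ ≠ ∞ := by
        refine ne_top_of_le_ne_top (b := ∑' k : ℕ, ENNReal.ofReal ((1 / 2 : ℝ) ^ k)) ?_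
          (ENNReal.tsum_le_tsum fun k => ?_)
        · rw [← ENNReal.ofReal_tsum_of_nonneg (fun k => by positivity) summable_geometric_two]
          exact ENNReal.ofReal_ne_top
        · rw [← ofReal_measureReal (measure_ne_top _ _)]
          exact ENNReal.ofReal_le_ofReal (hB k)
      filter_upwards [ae_eventually_notMem hsum] with x hx
      simpa using hx
    filter_upwards [hfin', hbc] with x hx hxB
    rw [EReal.eq_top_iff_forall_lt]
    intro c
    obtain ⟨m, hm⟩ := exists_nat_gt c
    refine lt_of_lt_of_le (EReal.coe_lt_coe_iff.2 hm) (le_limsup_of_frequently_le ?_)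
    rw [frequently_atTop]
    intro N₀
    obtain ⟨k, ⟨t, ht, hlarge⟩, hkm⟩ := (hxB.and (eventually_ge_atTop (max m N₀))).exists
    obtain ⟨hkt, hMt⟩ := hS k t ht
    refine ⟨2 ^ t, ?_, ?_⟩
    · exact (le_max_right m N₀).trans (hkm.trans (hkt.trans Nat.lt_two_pow_self.le))
    · rw [EReal.coe_le_coe_iff, le_div_iff₀ (hMpos _ Nat.one_le_two_pow)]
      have hfa : a k * khintchineSum ((E k).indicator 1) (2 ^ t) x ≤
          khintchineSum (fun x => (g x).toReal) (2 ^ t) x := by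
        rw [khintchineSum, Finset.mul_sum]
        refine Finset.sum_le_sum fun n hn => ?_
        have hn0 : n ≠ 0 := by have := (Finset.mem_Icc.1 hn).1; omega
        by_cases hnE : mulMod n x ∈ E k
        · have h1 : ENNReal.ofReal (a k) ≤ g (mulMod n x) := by
            refine le_trans ?_ (le_iSup _ k)
            simp [hnE]
          simpa [hnE] using (ENNReal.ofReal_le_iff_le_toReal (hx n hn0).ne).1 h1
        · simp [hnE]
      have hmk : (m : ℝ) ≤ k + 1 := by
        have : m ≤ k + 1 := (le_max_left m N₀).trans (hkm.trans (Nat.le_succ k))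
        exact_mod_cast this
      calc (m : ℝ) * M (2 ^ t) ≤ (k + 1) * M (2 ^ t) := by
            gcongr
            exact (hMpos _ Nat.one_le_two_pow).le
        _ ≤ a k * (2 ^ t / 2) := hMt
        _ ≤ a k * khintchineSum ((E k).indicator 1) (2 ^ t) x := by
            gcongr
            exact ha k
        _ ≤ _ := hfa

/-! ### Maximality of the rate -/

/-- A discrete form of integrating `x ^ (-s)`, obtained from Bernoulli's inequality for the exponent
`1 - s`; it makes the next sum telescope. -/
lemma rpow_neg_le_mul_rpow_sub {s : ℝ} (hs0 : 0 < s) (hs1 : s < 1) (N : ℕ) :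
    ((N : ℝ) + 1) ^ (-s) ≤ (1 - s)⁻¹ * (((N : ℝ) + 1) ^ (1 - s) - (N : ℝ) ^ (1 - s)) := by
  have hx : (0 : ℝ) < N + 1 := by positivity
  have h := rpow_one_add_le_one_add_mul_self (s := -(1 / ((N : ℝ) + 1))) (p := 1 - s)
    (by rw [neg_le_neg_iff, div_le_one hx]; linarith [N.cast_nonneg (α := ℝ)])
    (by linarith) (by linarith)
  have hN : (N : ℝ) = (N + 1) * (1 + -(1 / ((N : ℝ) + 1))) := by field_simp; ring
  have h1 : (N : ℝ) ^ (1 - s) ≤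
      ((N : ℝ) + 1) ^ (1 - s) * (1 + (1 - s) * -(1 / ((N : ℝ) + 1))) := by
    conv_lhs => rw [hN]
    rw [Real.mul_rpow hx.le (by
      rw [← sub_eq_add_neg, sub_nonneg, div_le_one hx]; linarith [N.cast_nonneg (α := ℝ)])]
    gcongr
  have h2 : ((N : ℝ) + 1) ^ (1 - s) * (1 / ((N : ℝ) + 1)) = ((N : ℝ) + 1) ^ (-s) := by
    rw [show -s = (1 - s) - 1 by ring, Real.rpow_sub_one hx.ne']
    ring
  rw [le_inv_mul_iff₀ (by linarith), ← h2]
  linarith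

lemma sum_rpow_neg_ite_le {s : ℝ} (hs0 : 0 < s) (hs1 : s < 1) {R : ℝ} (hR : 0 ≤ R) (N : ℕ) :
    ∑ t ∈ Finset.range N, (if (t : ℝ) + 1 < R then ((t : ℝ) + 1) ^ (-s) else 0) ≤
      (1 - s)⁻¹ * R ^ (1 - s) := by
  have hs : 0 < 1 - s := by linarith
  -- The bound with `min N R` is what induction on `N` can carry: it telescopes until `R` is reached
  -- and then stays put.
  suffices h : ∑ t ∈ Finset.range N, (if (t : ℝ) + 1 < R then ((t : ℝ) + 1) ^ (-s) else 0) ≤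
      (1 - s)⁻¹ * (min (N : ℝ) R) ^ (1 - s) by
    refine h.trans ?_
    gcongr
    exact min_le_right _ _
  induction N with
  | zero => simp [hR, Real.zero_rpow hs.ne']
  | succ N ih =>
    rw [Finset.sum_range_succ]
    push_cast
    split_ifs with h
    · rw [min_eq_left (by linarith)] at ih
      rw [min_eq_left h.le]
      have := rpow_neg_le_mul_rpow_sub hs0 hs1 N
      linarith
    · rw [add_zero]
      refine ih.trans ?_
      gcongr
      linarith

/-- Sum over dyadic scales of the normalised tails of a number. -/
lemma tsum_tail_le {p : ℝ} (hp : 1 < p) {v : ℝ} (hv : 0 ≤ v) :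
    ∑' t : ℕ, ENNReal.ofReal ((if ((t : ℝ) + 1) ^ (1 / p) < v then v else 0) /
      ((t : ℝ) + 1) ^ (1 / p)) ≤ ENNReal.ofReal ((1 - 1 / p)⁻¹ * v ^ p) := by
  have hp0 : 0 < p := one_pos.trans hp
  have hs1 : 1 / p < 1 := by rw [div_lt_one hp0]; exact hp
  refine ENNReal.tsum_le_of_sum_range_le fun N => ?_
  rw [← ENNReal.ofReal_sum_of_nonneg]
  · refine ENNReal.ofReal_le_ofReal ?_
    have h1 : ∀ t : ℕ, (if ((t : ℝ) + 1) ^ (1 / p) < v then v else 0) / ((t : ℝ) + 1) ^ (1 / p) =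
        (if (t : ℝ) + 1 < v ^ p then ((t : ℝ) + 1) ^ (-(1 / p)) else 0) * v := by
      intro t
      have h2 : ((t : ℝ) + 1) ^ (1 / p) < v ↔ (t : ℝ) + 1 < v ^ p := by
        rw [one_div, Real.rpow_inv_lt_iff_of_pos (by positivity) hv hp0]
      simp only [h2]
      split_ifs
      · rw [Real.rpow_neg (by positivity)]; ring
      · simp
    simp_rw [h1]
    rw [← Finset.sum_mul]
    refine (mul_le_mul_of_nonneg_right (sum_rpow_neg_ite_le (by positivity) hs1
      (Real.rpow_nonneg hv p) N) hv).trans_eq ?_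
    rw [mul_assoc, ← Real.rpow_mul hv]
    congr 1
    rcases hv.eq_or_lt with rfl | hv0
    · rw [mul_zero, Real.zero_rpow hp0.ne']
    · rw [← Real.rpow_add_one hv0.ne']
      congr 1
      field_simp
      ring
  · intro t _
    have : 0 ≤ ((t : ℝ) + 1) ^ (1 / p) := by positivity
    split_ifs <;> positivity

lemma lintegral_ofReal_khintchineSum {g : ℝ → ℝ} (hg : Measurable g) (hg0 : 0 ≤ g) (N : ℕ) :
    ∫⁻ x, ENNReal.ofReal (khintchineSum g N x) ∂unitMeasure =
      N * ∫⁻ x, ENNReal.ofReal (g x) ∂unitMeasure := by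
  have h1 : ∀ x, ENNReal.ofReal (khintchineSum g N x) =
      ∑ n ∈ Finset.Icc 1 N, ENNReal.ofReal (g (mulMod n x)) := fun x =>
    ENNReal.ofReal_sum_of_nonneg fun n _ => hg0 _
  simp_rw [h1]
  rw [lintegral_finsetSum (f := fun n x => ENNReal.ofReal (g (mulMod n x))) _ fun n _ => (hg.comp (measurable_mulMod n)).ennreal_ofReal]
  have h2 : ∀ n ∈ Finset.Icc 1 N, ∫⁻ x, ENNReal.ofReal (g (mulMod n x)) ∂unitMeasure =
      ∫⁻ x, ENNReal.ofReal (g x) ∂unitMeasure := fun n hn =>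
    (measurePreserving_mulMod (by have := (Finset.mem_Icc.1 hn).1; omega)).lintegral_comp
      hg.ennreal_ofReal
  rw [Finset.sum_congr rfl h2]
  simp

/-- The part of `f` below `η d t` contributes at most `η d t` per term. The tail `τ t` is handled by
Markov's inequality and Borel–Cantelli, with summability from `tsum_tail_le`; convergence there uses
`1 / p < 1`. -/
lemma ae_eventually_abs_khintchineSum_le {p : ℝ} (hp : 1 < p) {f : ℝ → ℝ} (hf : Measurable f)
    (hfp : ∫⁻ x, ENNReal.ofReal (|f x| ^ p) ∂unitMeasure < ∞) {η : ℝ} (hη : 0 < η) :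
    ∀ᵐ x ∂unitMeasure, ∀ᶠ t : ℕ in atTop, ∀ N ≤ 2 ^ (t + 1),
      |khintchineSum f N x| ≤ 2 * η * (2 ^ (t + 1) * ((t : ℝ) + 1) ^ (1 / p)) := by
  have hp0 : 0 < p := one_pos.trans hp
  let d : ℕ → ℝ := fun t => ((t : ℝ) + 1) ^ (1 / p)
  have hd : ∀ t, 0 < d t := fun t => by positivity
  let τ : ℕ → ℝ → ℝ := fun t x => if η * d t < |f x| then |f x| else 0
  have hτ0 : ∀ t, 0 ≤ τ t := fun t x => by
    simp only [τ]; split_ifs <;> simp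
  have hτm : ∀ t, Measurable (τ t) := fun t =>
    Measurable.ite (measurableSet_lt measurable_const hf.abs) hf.abs measurable_const
  have hmarkov : ∀ t, unitMeasure
      {x | η * d t * 2 ^ (t + 1) ≤ khintchineSum (τ t) (2 ^ (t + 1)) x} ≤
        ∫⁻ x, ENNReal.ofReal (τ t x / (η * d t)) ∂unitMeasure := by
    intro t
    have hpos : 0 < η * d t := mul_pos hη (hd t)
    have h1 := meas_ge_le_lintegral_div (μ := unitMeasure)
      (f := fun x => ENNReal.ofReal (khintchineSum (τ t) (2 ^ (t + 1)) x))
      (measurable_khintchineSum (hτm t) _).ennreal_ofReal.aemeasurable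
      (ε := ENNReal.ofReal (η * d t * 2 ^ (t + 1))) (by simp; positivity) ENNReal.ofReal_ne_top
    rw [lintegral_ofReal_khintchineSum (hτm t) (hτ0 t)] at h1
    refine (measure_mono fun x hx => ENNReal.ofReal_le_ofReal hx).trans (h1.trans_eq ?_)
    have h2 : ∀ x, ENNReal.ofReal (τ t x / (η * d t)) =
        (ENNReal.ofReal (η * d t))⁻¹ * ENNReal.ofReal (τ t x) := fun x => by
      rw [ENNReal.ofReal_div_of_pos hpos, div_eq_mul_inv, mul_comm]
    simp_rw [h2]
    rw [lintegral_const_mul _ (hτm t).ennreal_ofReal, ENNReal.ofReal_mul hpos.le,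
      ENNReal.ofReal_pow zero_le_two, ENNReal.ofReal_ofNat, mul_comm (ENNReal.ofReal (η * d t))]
    push_cast
    rw [ENNReal.mul_div_mul_left _ _ (by positivity) (by finiteness), div_eq_mul_inv, mul_comm]
  have hsum : ∑' t, unitMeasure
      {x | η * d t * 2 ^ (t + 1) ≤ khintchineSum (τ t) (2 ^ (t + 1)) x} ≠ ∞ := by
    refine ne_top_of_le_ne_top ?_ (ENNReal.tsum_le_tsum hmarkov)
    rw [← lintegral_tsum fun t => ((hτm t).div_const _).ennreal_ofReal.aemeasurable]
    have hpt : ∀ x, ∑' t, ENNReal.ofReal (τ t x / (η * d t)) ≤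
        ENNReal.ofReal ((1 - 1 / p)⁻¹ * (η⁻¹) ^ p) * ENNReal.ofReal (|f x| ^ p) := by
      intro x
      have hC : 0 ≤ (1 - 1 / p)⁻¹ :=
        inv_nonneg.2 (sub_nonneg.2 ((div_le_one hp0).2 hp.le))
      rw [← ENNReal.ofReal_mul (by positivity), mul_assoc,
        ← Real.mul_rpow (by positivity) (abs_nonneg _)]
      refine le_trans (le_of_eq ?_) (tsum_tail_le hp (by positivity))
      congr 1
      ext1 t
      congr 1
      have h3 : η * d t < |f x| ↔ ((t : ℝ) + 1) ^ (1 / p) < η⁻¹ * |f x| :=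
        (lt_inv_mul_iff₀ hη).symm
      simp only [τ, h3]
      split_ifs
      · simp only [d]; field_simp
      · simp
    refine ((lintegral_mono hpt).trans_lt ?_).ne
    rw [lintegral_const_mul _ (by fun_prop)]
    exact ENNReal.mul_lt_top ENNReal.ofReal_lt_top hfp
  filter_upwards [ae_eventually_notMem hsum] with x hx
  filter_upwards [hx] with t ht N hN
  simp only [not_le] at ht
  calc |khintchineSum f N x| ≤ ∑ n ∈ Finset.Icc 1 N, |f (mulMod n x)| :=
        Finset.abs_sum_le_sum_abs _ _
    _ ≤ ∑ n ∈ Finset.Icc 1 (2 ^ (t + 1)), |f (mulMod n x)| :=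
        Finset.sum_le_sum_of_subset_of_nonneg (Finset.Icc_subset_Icc_right hN)
          fun _ _ _ => abs_nonneg _
    _ ≤ ∑ n ∈ Finset.Icc 1 (2 ^ (t + 1)), (η * d t + τ t (mulMod n x)) := by
        refine Finset.sum_le_sum fun n _ => ?_
        simp only [τ]
        have := mul_pos hη (hd t)
        split_ifs <;> linarith
    _ = η * d t * 2 ^ (t + 1) + khintchineSum (τ t) (2 ^ (t + 1)) x := by
        rw [Finset.sum_add_distrib, khintchineSum]
        simp [mul_comm]
    _ ≤ 2 * η * (2 ^ (t + 1) * ((t : ℝ) + 1) ^ (1 / p)) := by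
        simp only [d] at ht ⊢
        linarith

/-- The constant is `2 · 2 · 4`: the initial `2`, a factor `2` from `2 ^ (t+1) ≤ 2 N`, and `4` from
`t + 1 ≤ 4 log N`. -/
lemma abs_div_rate_le {p : ℝ} (hp : 1 < p) {η a : ℝ} (hη : 0 < η) {t N : ℕ} (ht : 1 ≤ t)
    (hN : 2 ^ t ≤ N) (ha : |a| ≤ 2 * η * (2 ^ (t + 1) * ((t : ℝ) + 1) ^ (1 / p))) :
    |a / (N * Real.log N ^ (1 / p))| ≤ 16 * η := by
  have hp0 : 0 < p := one_pos.trans hp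
  have hs0 : 0 ≤ 1 / p := by positivity
  have hs1 : 1 / p ≤ 1 := by rw [div_le_one hp0]; exact hp.le
  have hN' : (2 : ℝ) ^ t ≤ N := by exact_mod_cast hN
  have ht' : (1 : ℝ) ≤ t := by exact_mod_cast ht
  have hlog : ((t : ℝ) + 1) / 4 ≤ Real.log N := by
    calc ((t : ℝ) + 1) / 4 ≤ t * Real.log 2 := by nlinarith [Real.log_two_gt_d9]
      _ = Real.log (2 ^ t) := by rw [Real.log_pow]
      _ ≤ Real.log N := Real.log_le_log (by positivity) hN'
  have hlog0 : 0 < Real.log N := lt_of_lt_of_le (by positivity) hlog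
  have hN0 : (0 : ℝ) < N := lt_of_lt_of_le (by positivity) hN'
  have hpow : ((t : ℝ) + 1) ^ (1 / p) ≤ 4 * Real.log N ^ (1 / p) := by
    calc ((t : ℝ) + 1) ^ (1 / p) ≤ (4 * Real.log N) ^ (1 / p) := by gcongr; linarith
      _ = 4 ^ (1 / p) * Real.log N ^ (1 / p) := Real.mul_rpow (by norm_num) hlog0.le
      _ ≤ 4 ^ (1 : ℝ) * Real.log N ^ (1 / p) := by gcongr; norm_num
      _ = 4 * Real.log N ^ (1 / p) := by rw [Real.rpow_one]
  have hden : 0 < (N : ℝ) * Real.log N ^ (1 / p) := by positivity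
  rw [abs_div, abs_of_pos hden, div_le_iff₀ hden]
  calc |a| ≤ 2 * η * (2 ^ (t + 1) * ((t : ℝ) + 1) ^ (1 / p)) := ha
    _ ≤ 2 * η * ((2 * N) * (4 * Real.log N ^ (1 / p))) := by
        gcongr
        rw [pow_succ]
        linarith
    _ = 16 * η * (N * Real.log N ^ (1 / p)) := by ring

lemma ae_tendsto_khintchineSum_of_measurable {p : ℝ} (hp : 1 < p) {f : ℝ → ℝ} (hf : Measurable f)
    (hfp : ∫⁻ x, ENNReal.ofReal (|f x| ^ p) ∂unitMeasure < ∞) :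
    ∀ᵐ x ∂unitMeasure, Tendsto (fun N : ℕ =>
      khintchineSum f N x / (N * Real.log N ^ (1 / p))) atTop (𝓝 0) := by
  have h : ∀ᵐ x ∂unitMeasure, ∀ m : ℕ, ∀ᶠ t : ℕ in atTop, ∀ N ≤ 2 ^ (t + 1),
      |khintchineSum f N x| ≤
        2 * (1 / ((m : ℝ) + 1)) * (2 ^ (t + 1) * ((t : ℝ) + 1) ^ (1 / p)) := by
    rw [ae_all_iff]
    exact fun m => ae_eventually_abs_khintchineSum_le hp hf hfp (by positivity)
  filter_upwards [h] with x hx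
  rw [Metric.tendsto_atTop]
  intro ε hε
  obtain ⟨m, hm⟩ := exists_nat_one_div_lt (show 0 < ε / 16 by positivity)
  obtain ⟨t₀, ht₀⟩ := eventually_atTop.1 (hx m)
  -- The extra `1` ensures that the scale `Nat.log 2 N` is at least `1`, as `abs_div_rate_le`
  -- requires.
  refine ⟨2 ^ (t₀ + 1), fun N hN => ?_⟩
  have hN0 : N ≠ 0 := by have := Nat.two_pow_pos (t₀ + 1); omega
  have hlog : t₀ + 1 ≤ Nat.log 2 N := Nat.le_log_of_pow_le one_lt_two hN
  rw [Real.dist_eq, sub_zero]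
  refine (abs_div_rate_le hp (by positivity) (by omega) (Nat.pow_log_le_self 2 hN0)
    (ht₀ _ (by omega) N (Nat.lt_pow_succ_log_self one_lt_two N).le)).trans_lt ?_
  linarith

theorem ae_tendsto_khintchineSum {p : ℝ} (hp : 1 < p) {f : ℝ → ℝ}
    (hf : MemLp f (ENNReal.ofReal p) unitMeasure) :
    ∀ᵐ x ∂unitMeasure, Tendsto (fun N : ℕ =>
      khintchineSum f N x / (N * Real.log N ^ (1 / p))) atTop (𝓝 0) := by
  have hp0 : 0 < p := one_pos.trans hp
  set g := hf.1.mk f with hg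
  have hfg : f =ᵐ[unitMeasure] g := hf.1.ae_eq_mk
  have hgm : Measurable g := hf.1.stronglyMeasurable_mk.measurable
  have hgp : ∫⁻ x, ENNReal.ofReal (|g x| ^ p) ∂unitMeasure < ∞ := by
    have h1 := (hf.ae_eq hfg).2
    rw [eLpNorm_lt_top_iff_lintegral_rpow_enorm_lt_top (by simpa using hp0) ENNReal.ofReal_ne_top,
      ENNReal.toReal_ofReal hp0.le] at h1
    refine lt_of_le_of_lt (le_of_eq (lintegral_congr fun x => ?_)) h1
    rw [← ENNReal.ofReal_rpow_of_nonneg (abs_nonneg _) hp0.le, Real.enorm_eq_ofReal_abs]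
  have hall : ∀ᵐ x ∂unitMeasure, ∀ n : ℕ, n ≠ 0 → f (mulMod n x) = g (mulMod n x) := by
    rw [ae_all_iff]
    intro n
    by_cases hn : n = 0
    · simp [hn]
    · filter_upwards
        [(measurePreserving_mulMod hn).quasiMeasurePreserving.ae_eq_comp hfg] with x hx _
      exact hx
  filter_upwards [hall, ae_tendsto_khintchineSum_of_measurable hp hgm hgp] with x hx hlim
  refine hlim.congr fun N => ?_
  congr 1
  exact Finset.sum_congr rfl fun n hn =>
    (hx n (by have := (Finset.mem_Icc.1 hn).1; omega)).symm

end KhintchineSums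

theorem mainTheorem8 (p : ℝ) (hp : 1 < p) :
    KhintchineSums.UltimatelyBad (KhintchineSums.khintchineOp p) ∧
    (∀ M : ℕ → ℝ, (∀ N, 1 ≤ N → 0 < M N) →
      Tendsto (fun N : ℕ => M N / (N * Real.log N ^ (1 / p))) atTop (𝓝 0) →
      ∃ f : ℝ → ℝ, MemLp f (ENNReal.ofReal p) KhintchineSums.unitMeasure ∧
        ∀ᵐ x ∂KhintchineSums.unitMeasure,
          limsup (fun N : ℕ => ((KhintchineSums.khintchineSum f N x / M N : ℝ) : EReal)) atTop
            = ⊤) ∧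
    (∀ f : ℝ → ℝ, MemLp f (ENNReal.ofReal p) KhintchineSums.unitMeasure →
      ∀ᵐ x ∂KhintchineSums.unitMeasure,
        Tendsto (fun N : ℕ =>
          KhintchineSums.khintchineSum f N x / (N * Real.log N ^ (1 / p))) atTop (𝓝 0)) :=
  ⟨KhintchineSums.ultimatelyBad_khintchineOp hp,
    fun _ hMpos hM => KhintchineSums.exists_memLp_limsup_khintchineSum_eq_top hp hMpos hM,
    fun _ hf => KhintchineSums.ae_tendsto_khintchineSum hp hf⟩
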